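/- Write $\mathbb N$ for the positive integers and $\mathbb N_0=\mathbb N\cup\{0\}$. Let $\kappa\ge 3$ and $0\le\lambda\le\kappa-2$ be integers, and let $V_{\kappa,\lambda}$ be the set of all $(\gamma,\alpha,\beta)\in\mathbb N_0^3$ with $\beta,\gamma\ge 1$, $\gamma+\alpha+\beta=\kappa$ and $\alpha\ge\max\{\lambda+1-\beta,\lambda+1-\gamma\}$. A $(\kappa,\lambda)$-graphical sequence is a sequence $\mathcal G=\big((\gamma_i,\alpha_i,\beta_i)\big)_{i=1}^{g+1}$ of distinct elements of $\mathbb N_0^3$ such that $(\gamma_i,\alpha_i,\beta_i)\in V_{\kappa,\lambda}$ for $1\le i\le g$; $(\gamma_1,\alpha_1,\beta_1)=(1,\lambda,\kappa-\lambda-1)$; $\beta_i\ge\beta_{i+1}$ for $1\le i\le g-1$ and $\gamma_i\le\gamma_{i+1}$ for $1\le i\le g$; $\beta_{g+1}=0$ and $\gamma_{g+1}+\alpha_{g+1}=\kappa$. Given such a $\mathcal G$ and a function $\ell:\{1,\dots,g+1\}\to\mathbb N$ with $\ell(g+1)=1$, put $s(i)=1+\sum_{j<i}\ell(j)$ for $1\le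 i\le g+1$, and let $\mathcal T=\mathcal T(\mathcal G,\ell)=\big((c_m,a_m,b_m)\big)_{m=1}^{D_{\mathcal T}}$, where $D_{\mathcal T}=s(g+1)$ and $(c_{s(i)+j},a_{s(i)+j},b_{s(i)+j})=(\gamma_i,\alpha_i,\beta_i)$ for $1\le i\le g+1$ and $0\le j<\ell(i)$. Let $h_{\mathcal T}=\ell(1)$ and let $t_{\mathcal T}$ be the number of $i$ with $h_{\mathcal T}<i\le D_{\mathcal T}$ and $(c_i,a_i,b_i)=(\kappa-\lambda-1,\lambda,1)$. Let $D=D_{\mathcal T}$, $b_0=\kappa$, $a_0=c_0=0$, and let $L_1(\mathcal T)$ be the $(D+1)\times(D+1)$ tridiagonal matrix with rows indexed by $0,\dots,D$, whose row $i$ has the entries $c_i,a_i,b_i$ in columns $i-1,i,i+1$ (those that exist). Its eigenvalues, which are all real, are called the eigenvalues of $\mathcal T$. Define polynomials by $v_0=1$, $v_1=x$ and $x v_i=b_{i-1}v_{i-1}+a_iv_i+c_{i+1}v_{i+1}$ for $1\le i\le D-1$, and put $\kappa_i=v_i(\kappa)$ for $0\le i\le D$. The Christoffel number of $\mathcal T$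 associated with an eigenvalue $\theta$ is $\Big(\sum_{j=0}^{D}\kappa_j\Big)\Big/\Big(\sum_{j=0}^{D}v_j(\theta)^2/\kappa_j\Big)$. Property (AC) for $\mathcal T$: any two eigenvalues of $\mathcal T$ that are algebraically conjugate over $\mathbb Q$ have the same Christoffel number. **Proposition.** Let $\kappa\ge 3$ and $0\le\lambda\le\kappa-2$ be integers, let $\mathcal G=\big((\gamma_i,\alpha_i,\beta_i)\big)_{i=1}^{g+1}$ be a $(\kappa,\lambda)$-graphical sequence, let $\epsilon>0$ be a real number, and let $C=C(\kappa)>0$ be a real constant depending only on $\kappa$. Then there is a constant $H=H(\kappa,\lambda,\epsilon,\mathcal G)>0$ (for the given function $C(\kappa)$; in particular $H$ does not depend on $\ell$) such that, for every function $\ell:\{1,\dots,g+1\}\to\mathbb N$ with $\ell(g+1)=1$ for which $\mathcal T=\mathcal T(\mathcal G,\ell)$ satisfies (i) Property (AC), (ii) $D_{\mathcal T}\le C\,h_{\mathcal T}$, and (iii) $D_{\mathcal T}-(h_{\mathcal T}+t_{\mathcal T})>\epsilon\,h_{\mathcal T}$, one has $h_{\mathcal T}\le H$. -/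

import Mathlib

open Finset

namespace BannaiIto

/-- Triples `(γ, α, β)` of nonnegative integers, in this order. -/
abbrev Triple : Type := ℕ × ℕ × ℕ

namespace Triple

/-- The first entry `γ` of a triple `(γ, α, β)`. -/
abbrev gam (p : Triple) : ℕ := p.1

/-- The second entry `α` of a triple `(γ, α, β)`. -/
abbrev alp (p : Triple) : ℕ := p.2.1

/-- The third entry `β` of a triple `(γ, α, β)`. -/
abbrev bet (p : Triple) : ℕ := p.2.2

end Triple

/-! ### Tridiagonal matrices and their Christoffel numbers -/

/-- The `(n+1) × (n+1)` tridiagonal matrix whose row `i` (for `0 ≤ i ≤ n`) has the entries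
`γ i`, `α i`, `β i` in the columns `i - 1`, `i`, `i + 1` (as far as these columns exist). -/
def triMatrix (n : ℕ) (γ α β : ℕ → ℝ) : Matrix (Fin (n + 1)) (Fin (n + 1)) ℝ :=
  Matrix.of fun i j =>
    if (j : ℕ) + 1 = i then γ i
    else if (j : ℕ) = i then α i
    else if (j : ℕ) = i + 1 then β i
    else 0

/-- The value at `x` of the polynomial `v_i` given by `v_0 = 1`, `v_1 = x` and
`x v_i = β_{i-1} v_{i-1} + α_i v_i + γ_{i+1} v_{i+1}` for `i ≥ 1`. -/
noncomputable def vPoly (γ α β : ℕ → ℝ) (x : ℝ) : ℕ → ℝ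
  | 0 => 1
  | 1 => x
  | i + 2 => ((x - α (i + 1)) * vPoly γ α β x (i + 1) - β i * vPoly γ α β x i) / γ (i + 2)

/-- The numbers `κ_i = v_i(κ)`, where `κ = β_0`. -/
noncomputable def kappa (γ α β : ℕ → ℝ) (i : ℕ) : ℝ := vPoly γ α β (β 0) i

/-- The Christoffel number of the tridiagonal matrix with rows `0, …, n` that is associated with
its eigenvalue `θ`, namely `(∑ j, κ_j) / (∑ j, v_j(θ)² / κ_j)`, the sums being over
`0 ≤ j ≤ n`. -/
noncomputable def christoffel (n : ℕ) (γ α β : ℕ → ℝ) (θ : ℝ) : ℝ :=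
  (∑ j ∈ range (n + 1), kappa γ α β j) /
    ∑ j ∈ range (n + 1), vPoly γ α β θ j ^ 2 / kappa γ α β j

/-! ### Graphical sequences -/

/-- The set `V_{κ,λ}` of triples `(γ, α, β)` with `β, γ ≥ 1`, `γ + α + β = κ` and
`α ≥ max {λ + 1 - β, λ + 1 - γ}`. -/
def tripleSet (κ lam : ℕ) : Set Triple :=
  {p | 1 ≤ p.bet ∧ 1 ≤ p.gam ∧ p.gam + p.alp + p.bet = κ ∧
    lam + 1 ≤ p.alp + p.bet ∧ lam + 1 ≤ p.alp + p.gam}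

/-- A `(κ, λ)`-graphical sequence `(δ_i)_{i=1}^{g+1}`; the term `δ_i` is `G (i - 1)`, so that the
indices run through `Fin (g + 1)`. It is used for `κ ≥ 3` and `0 ≤ λ ≤ κ - 2` only. -/
structure IsGraphical (κ lam : ℕ) {g : ℕ} (G : Fin (g + 1) → Triple) : Prop where
  distinct : Function.Injective G
  mem_tripleSet : ∀ i : Fin g, G i.castSucc ∈ tripleSet κ lam
  first : G 0 = (1, lam, κ - lam - 1)
  bet_antitone : ∀ i : Fin g, (i : ℕ) + 1 < g → (G i.succ).bet ≤ (G i.castSucc).bet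
  gam_monotone : ∀ i : Fin g, (G i.castSucc).gam ≤ (G i.succ).gam
  last_bet : (G (Fin.last g)).bet = 0
  last_sum : (G (Fin.last g)).gam + (G (Fin.last g)).alp = κ

/-! ### Tridiagonal sequences -/

section TridiagonalSequence

variable {g : ℕ}

/-- The position `s(i) = 1 + ∑_{j < i} ℓ(j)` at which the `i`-th block begins (positions are
counted from `1`). -/
def start (l : Fin (g + 1) → ℕ) (i : Fin (g + 1)) : ℕ := 1 + ∑ j ∈ Iio i, l j

/-- The block that contains the position `m ≥ 1`: the largest `i` with `s(i) ≤ m`. -/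
noncomputable def block (l : Fin (g + 1) → ℕ) (m : ℕ) : Fin (g + 1) :=
  (univ.filter fun i => start l i ≤ m).sup id

/-- The `m`-th term `(c_m, a_m, b_m)` of the tridiagonal sequence `𝒯(𝒢, ℓ)`. It is meant for
`1 ≤ m ≤ s(g+1)` only. -/
noncomputable def tridiag (G : Fin (g + 1) → Triple) (l : Fin (g + 1) → ℕ) (m : ℕ) : Triple := G (block l m)

theorem start_add_le (l : Fin (g + 1) → ℕ) {i k : Fin (g + 1)} (h : i < k) :
    start l i + l i ≤ start l k := by
  have h1 : insert i (Iio i) ⊆ Iio k := by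
    intro x hx
    simp only [mem_insert, mem_Iio] at hx ⊢
    rcases hx with rfl | hx
    · exact h
    · exact hx.trans h
  have h2 := sum_le_sum_of_subset (f := l) h1
  rw [sum_insert (by simp)] at h2
  simp only [start]
  omega

/-- The defining property of `𝒯(𝒢, ℓ)`: its terms at the positions `s(i), …, s(i) + ℓ(i) - 1`
are all equal to the `i`-th term of `𝒢`. -/
theorem tridiag_start_add (G : Fin (g + 1) → Triple) (l : Fin (g + 1) → ℕ) (i : Fin (g + 1))
    {j : ℕ} (hj : j < l i) : tridiag G l (start l i + j) = G i := by
  have hb : block l (start l i + j) = i := by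
    apply le_antisymm
    · refine Finset.sup_le fun k hk => ?_
      simp only [mem_filter, mem_univ, true_and] at hk
      by_contra hik
      have h1 := start_add_le l (not_le.mp hik)
      simp only [id] at h1
      omega
    · exact Finset.le_sup (f := id) (by simp)
  simp only [tridiag, hb]

/-- The head `h = ℓ(1)`. -/
def head (l : Fin (g + 1) → ℕ) : ℕ := l 0

/-- The diameter `D = s(g+1)`. -/
def diam (l : Fin (g + 1) → ℕ) : ℕ := start l (Fin.last g)

/-- The tail `t`: the number of positions `i` with `h < i ≤ D` at which the tridiagonal sequence
has the term `(κ - λ - 1, λ, 1)`. -/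
noncomputable def tail (κ lam : ℕ) (G : Fin (g + 1) → Triple) (l : Fin (g + 1) → ℕ) : ℕ :=
  ((Ioc (head l) (diam l)).filter fun i => tridiag G l i = (κ - lam - 1, lam, 1)).card

/-- The numbers `c_m`, with `c_0 = 0`. -/
noncomputable def cSeq (G : Fin (g + 1) → Triple) (l : Fin (g + 1) → ℕ) (m : ℕ) : ℝ :=
  if m = 0 then 0 else ((tridiag G l m).gam : ℝ)

/-- The numbers `a_m`, with `a_0 = 0`. -/
noncomputable def aSeq (G : Fin (g + 1) → Triple) (l : Fin (g + 1) → ℕ) (m : ℕ) : ℝ :=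
  if m = 0 then 0 else ((tridiag G l m).alp : ℝ)

/-- The numbers `b_m`, with `b_0 = κ`. -/
noncomputable def bSeq (κ : ℕ) (G : Fin (g + 1) → Triple) (l : Fin (g + 1) → ℕ) (m : ℕ) : ℝ :=
  if m = 0 then (κ : ℝ) else ((tridiag G l m).bet : ℝ)

/-- The tridiagonal matrix `L₁(𝒯)`, with rows `(0, κ)`, `(c_1, a_1, b_1)`, …, `(c_D, a_D)`. -/
noncomputable def lMatrix (κ : ℕ) (G : Fin (g + 1) → Triple) (l : Fin (g + 1) → ℕ) :
    Matrix (Fin (diam l + 1)) (Fin (diam l + 1)) ℝ :=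
  triMatrix (diam l) (cSeq G l) (aSeq G l) (bSeq κ G l)

/-- The eigenvalues of `𝒯`, that is, those of `L₁(𝒯)` (they are all real). -/
def IsEigenvalue (κ : ℕ) (G : Fin (g + 1) → Triple) (l : Fin (g + 1) → ℕ) (θ : ℝ) : Prop :=
  Module.End.HasEigenvalue (Matrix.toLin' (lMatrix κ G l)) θ

/-- The Christoffel number of `𝒯` associated with its eigenvalue `θ`. -/
noncomputable def christoffelNumber (κ : ℕ) (G : Fin (g + 1) → Triple) (l : Fin (g + 1) → ℕ)
    (θ : ℝ) : ℝ :=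
  christoffel (diam l) (cSeq G l) (aSeq G l) (bSeq κ G l) θ

/-- Property (AC): any two eigenvalues of `𝒯` that are algebraically conjugate over `ℚ` have the
same Christoffel numbers. -/
def PropertyAC (κ : ℕ) (G : Fin (g + 1) → Triple) (l : Fin (g + 1) → ℕ) : Prop :=
  ∀ θ η : ℝ, IsEigenvalue κ G l θ → IsEigenvalue κ G l η → IsConjRoot ℚ θ η →
    christoffelNumber κ G l θ = christoffelNumber κ G l η

end TridiagonalSequence

end BannaiIto

namespace BannaiIto

/-! ### Separation of conjugate algebraic integers -/

section Conjugates

open Polynomial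

/-! Write an eigenvalue as `θ = κ - s²`. A block of constant rows `(γ, α, β)` has the spectral
interval given by `|√β - √γ| ≤ s ≤ √β + √γ`: inside it solutions of the three-term recurrence
oscillate, outside it they can grow or decay exponentially. For every block other than the head, the
tail and the last term, this interval reaches further to the right than that of the head
(`abs_sqrt_sub_lt`). By (iii) some such block `i₀` has length at least a fixed multiple of `h`,
unless `h` is bounded.

Fix a short interval of `θ` inside the spectral interval of `i₀` and to the right of that of the
head (`exists_interval`). Two facts about it conflict when `h` is large.

Many eigenvalues: cutting block `i₀` into windows and putting a Chebyshev-type solution on each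
gives disjointly supported approximate eigenvectors, hence at least a fixed multiple of `h`, up to a
bounded error, of eigenvalues in the interval (`exists_eigenvalues`).

Few eigenvalues: by (AC) conjugate eigenvalues have eigenvectors, normalised at position 0, of equal
norm. The eigenvector grows through an initial zone containing the head, changes by a bounded factor
in each oscillating block, and decays in a final zone, so its norm is governed by its value at the
end of the initial zone (`exists_sqNorm_le`). For two distinct `θ` these values separate
exponentially in `h` (`forward_compare`), so conjugates in the interval lie within a small `δ` of
each other (`pow_head_le`). Discriminants of minimal polynomials are nonzero integers, which lets
such clusters hold only a small proportion of all `D + 1 ≤ (C + 1)h` eigenvalues, up to finitely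
many exceptions (`card_le_of_conjugates_close`).

The norm estimate loses a factor per row in blocks with small `√β + √γ`, whose spectral interval
lies wholly to the right of `κ - σ²`. If those blocks are short compared with `h`, the loss is
affordable (`head_bounded_of_short`); otherwise one of them takes the role of `i₀`, and induction on
the number of blocks with smaller `√β + √γ` finishes (`head_bounded_of_long`). -/

theorem prod_eq_multiset_prod_of_nodup {M : Multiset ℝ} (hM : M.Nodup) {β : Type*}
    [CommMonoid β] (φ : ℝ → β) : ∏ x ∈ M.toFinset, φ x = (M.map φ).prod := by
  rw [Finset.prod_eq_multiset_prod, Multiset.toFinset_val, hM.dedup]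

/-- The discriminant of a monic separable integer polynomial with real roots is at least `1`. -/
theorem one_le_prod_root_differences (f : ℤ[X]) (hf : f.Monic)
    (hs : (f.map (Int.castRingHom ℝ)).Splits) (hn : (f.map (Int.castRingHom ℝ)).roots.Nodup) :
    1 ≤ ∏ x ∈ (f.map (Int.castRingHom ℝ)).roots.toFinset,
      ∏ y ∈ (f.map (Int.castRingHom ℝ)).roots.toFinset.erase x, |x - y| := by
  set F := f.map (Int.castRingHom ℝ) with hF
  set K := F.roots.toFinset with hK
  have hFm : F.Monic := hf.map _
  have hprod : F = ∏ x ∈ K, (X - C x) := by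
    conv_lhs => rw [hs.eq_prod_roots_of_monic hFm]
    rw [hK]
    exact (prod_eq_multiset_prod_of_nodup hn _).symm
  have hder : ∀ x ∈ K, (derivative F).eval x = ∏ y ∈ K.erase x, (x - y) := by
    intro x hx
    rw [hprod, derivative_prod_finset, eval_finsetSum, Finset.sum_eq_single x]
    · simp [eval_prod]
    · intro y hy hyx
      simp only [eval_prod, derivative_X_sub_C, mul_one]
      exact Finset.prod_eq_zero (Finset.mem_erase.2 ⟨hyx.symm, hx⟩) (by simp)
    · exact fun h => absurd hx h
  -- The resultant of `f` and its derivative is an integer, and over `ℝ` it is the product of the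
  -- values of the derivative at the roots.
  have hres : ((resultant f (derivative f) f.natDegree (derivative f).natDegree : ℤ) : ℝ) =
      ∏ x ∈ K, ∏ y ∈ K.erase x, (x - y) := by
    have h1 := resultant_eq_prod_eval F (derivative F) (derivative f).natDegree
      (by rw [hF, derivative_map]; exact natDegree_map_le) hs
    rw [hFm.leadingCoeff, one_pow, one_mul] at h1
    have h2 : F.natDegree = f.natDegree := hf.natDegree_map _
    rw [h2, hF, derivative_map, resultant_map_map] at h1
    rw [← eq_intCast (Int.castRingHom ℝ), h1, ← derivative_map, ← hF]
    rw [← Finset.prod_congr rfl hder, hK]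
    exact (prod_eq_multiset_prod_of_nodup hn _).symm
  have hne : ∏ x ∈ K, ∏ y ∈ K.erase x, (x - y) ≠ 0 := by
    refine Finset.prod_ne_zero_iff.2 fun x _ => Finset.prod_ne_zero_iff.2 fun y hy => ?_
    exact sub_ne_zero.2 (Finset.ne_of_mem_erase hy).symm
  rw [← hres, Int.cast_ne_zero] at hne
  have h1 : (1 : ℝ) ≤ |((resultant f (derivative f) f.natDegree (derivative f).natDegree : ℤ) : ℝ)| := by
    exact_mod_cast Int.one_le_abs hne
  rw [hres, Finset.abs_prod] at h1
  simpa only [Finset.abs_prod] using h1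

/-- If the product of the differences of a finite set of reals in `[-R, R]` is at least `1`, then
a subset of diameter at most `exp (-L)` is small. -/
theorem card_le_of_prod_differences {R L a : ℝ} (hR : 1 ≤ R) (hL : 0 < L) (ha : 0 ≤ a)
    (haL : Real.log (2 * R) ≤ a ^ 2 * L) (K S : Finset ℝ) (hS : S ⊆ K) (hK : ∀ x ∈ K, |x| ≤ R)
    (hprod : 1 ≤ ∏ x ∈ K, ∏ y ∈ K.erase x, |x - y|)
    (hclose : ∀ x ∈ S, ∀ y ∈ S, |x - y| ≤ Real.exp (-L)) :
    (#S : ℝ) ≤ 1 + a * #K := by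
  rcases S.eq_empty_or_nonempty with rfl | hSne
  · simp; positivity
  have hK1 : 1 ≤ #K := (Finset.card_pos.2 (hSne.mono hS))
  have hS1 : 1 ≤ #S := Finset.card_pos.2 hSne
  have h2R : (1 : ℝ) ≤ 2 * R := by linarith
  have hxy : ∀ x ∈ K, ∀ y ∈ K, |x - y| ≤ 2 * R := fun x hx y hy => by
    have := abs_sub x y; have := hK x hx; have := hK y hy
    linarith
  have hlog : 0 ≤ Real.log (2 * R) := Real.log_nonneg h2R
  have hpos : ∀ x ∈ K, ∀ y ∈ K.erase x, 0 < |x - y| := fun x _ y hy =>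
    abs_pos.2 (sub_ne_zero.2 (Finset.ne_of_mem_erase hy).symm)
  have hsum : 0 ≤ ∑ x ∈ K, ∑ y ∈ K.erase x, Real.log |x - y| := by
    have h1 := Real.log_nonneg hprod
    rw [Real.log_prod fun x hx => (Finset.prod_pos (hpos x hx)).ne'] at h1
    refine h1.trans_eq (Finset.sum_congr rfl fun x hx => ?_)
    exact Real.log_prod fun y hy => (hpos x hx y hy).ne'
  -- Every factor contributes at most `log (2R)`. A pair inside `S` contributes at most `-L`, which
  -- is at most `log (2R) - L` because `log (2R) ≥ 0`.
  have hinner : ∀ x ∈ K, ∑ y ∈ K.erase x, Real.log |x - y| ≤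
      #K * Real.log (2 * R) - if x ∈ S then (#S - 1 : ℝ) * L else 0 := by
    intro x hx
    have hle : ∑ y ∈ K.erase x, Real.log |x - y| ≤
        ∑ y ∈ K.erase x, (Real.log (2 * R) - if x ∈ S ∧ y ∈ S then L else 0) := by
      refine Finset.sum_le_sum fun y hy => ?_
      split_ifs with h
      · have := Real.log_le_log (hpos x hx y hy) (hclose x h.1 y h.2)
        rw [Real.log_exp] at this
        linarith
      · rw [sub_zero]
        exact Real.log_le_log (hpos x hx y hy) (hxy x hx y (Finset.mem_of_mem_erase hy))
    refine hle.trans ?_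
    rw [Finset.sum_sub_distrib, Finset.sum_const, nsmul_eq_mul]
    have hc : ((#(K.erase x) : ℕ) : ℝ) ≤ #K := by exact_mod_cast Finset.card_erase_le
    have h2 : (if x ∈ S then (#S - 1 : ℝ) * L else 0) ≤
        ∑ y ∈ K.erase x, if x ∈ S ∧ y ∈ S then L else 0 := by
      split_ifs with h
      · simp only [h, true_and]
        rw [← Finset.sum_filter, Finset.sum_const, nsmul_eq_mul]
        have h3 : #(S.erase x) ≤ #{y ∈ K.erase x | y ∈ S} := by
          refine Finset.card_le_card fun y hy => ?_
          rw [Finset.mem_erase] at hy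
          simp [hy.1, hy.2, hS hy.2]
        rw [Finset.card_erase_of_mem h] at h3
        have h4 : (#S - 1 : ℝ) ≤ (#{y ∈ K.erase x | y ∈ S} : ℝ) := by
          have : ((#S - 1 : ℕ) : ℝ) = #S - 1 := by push_cast [hS1]; ring
          rw [← this]; exact_mod_cast h3
        gcongr
      · simp [h]
    nlinarith
  have htot := hsum.trans (Finset.sum_le_sum hinner)
  rw [Finset.sum_sub_distrib, Finset.sum_const, nsmul_eq_mul, ← Finset.sum_filter,
    Finset.sum_const, nsmul_eq_mul] at htot
  have hfil : {x ∈ K | x ∈ S} = S := by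
    ext x; simp only [Finset.mem_filter]; exact ⟨fun h => h.2, fun h => ⟨hS h, h⟩⟩
  rw [hfil] at htot
  have hSr : (1 : ℝ) ≤ #S := by exact_mod_cast hS1
  -- Summation over `x` gives `#S (#S - 1) L ≤ #K² log (2R)`, and the right side is at most `(a #K)²
  -- L` by `haL`.
  have h5 : (#S - 1 : ℝ) ^ 2 * L ≤ (a * #K) ^ 2 * L := by
    have h6 : (#S - 1 : ℝ) ^ 2 * L ≤ #S * ((#S - 1) * L) := by nlinarith [mul_nonneg (sub_nonneg.2 hSr) hL.le]
    have h7 : (#K : ℝ) * (#K * Real.log (2 * R)) ≤ #K * (#K * (a ^ 2 * L)) := by gcongr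
    nlinarith
  have h8 := le_of_mul_le_mul_right h5 hL
  have h9 := abs_le_of_sq_le_sq h8 (by positivity)
  linarith [le_abs_self (#S - 1 : ℝ)]

/-- There are finitely many algebraic integers of bounded degree all of whose conjugates are real
and bounded. -/
theorem finite_integral_of_roots_le (R : ℝ) (N : ℕ) :
    {x : ℝ | ∃ f : ℤ[X], f.Monic ∧ f.natDegree ≤ N ∧ (f.map (Int.castRingHom ℝ)).Splits ∧
      (∀ y ∈ (f.map (Int.castRingHom ℝ)).roots, |y| ≤ R) ∧
      x ∈ (f.map (Int.castRingHom ℝ)).roots}.Finite := by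
  classical
  -- The coefficients are elementary symmetric functions of the roots, hence bounded by `B`; being
  -- integers, they leave finitely many polynomials.
  set B := max R 1 ^ N * N.choose (N / 2) with hB
  refine (bUnion_roots_finite (Int.castRingHom ℝ) N
    (Set.finite_Icc (-(Nat.ceil B : ℤ)) (Nat.ceil B))).subset ?_
  rintro x ⟨f, hf, hdeg, hs, hR, hx⟩
  simp only [Set.mem_iUnion]
  refine ⟨f, ⟨hdeg, fun i => ?_⟩, by simpa using hx⟩
  rw [Set.mem_Icc, ← abs_le]
  have hmap : (f.map (Int.castRingHom ℝ)).map (RingHom.id ℝ) = f.map (Int.castRingHom ℝ) := by simp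
  have h := coeff_bdd_of_roots_le (RingHom.id ℝ) (p := f.map (Int.castRingHom ℝ)) (B := R) (d := N)
    (hf.map _) (by rwa [hmap]) ((hf.natDegree_map _).trans_le hdeg)
    (by rw [hmap]; exact hR) i
  rw [hmap, coeff_map, eq_intCast, Real.norm_eq_abs] at h
  have h2 := h.trans (Nat.le_ceil B)
  exact_mod_cast h2

/-- Among the roots of a totally real integer polynomial with bounded simple roots, a set in
which conjugates are very close to one another contains only a small proportion of the roots,
up to a bounded number of exceptions. -/
theorem card_le_of_conjugates_close (R : ℝ) (hR : 1 ≤ R) (η : ℝ) (hη : 0 < η) :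
    ∃ δ : ℝ, 0 < δ ∧ ∃ B : ℕ, ∀ p : ℤ[X], p.Monic → (p.map (Int.castRingHom ℝ)).Splits →
      (p.map (Int.castRingHom ℝ)).roots.Nodup →
      (∀ x ∈ (p.map (Int.castRingHom ℝ)).roots, |x| ≤ R) →
      ∀ S ⊆ (p.map (Int.castRingHom ℝ)).roots.toFinset,
        (∀ x ∈ S, ∀ y ∈ S, IsConjRoot ℚ x y → |x - y| ≤ δ) →
        (#S : ℝ) ≤ B + η * p.natDegree := by
  classical
  -- Roots of degree at most `N` are the finitely many exceptions. Above degree `N`, the summand 1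
  -- in the bound `1 + (η/2) · degree` is absorbed by a second `(η/2) · degree`. The choice of `L`
  -- ensures `log (2R) ≤ (η/2)² L`.
  obtain ⟨N, hN⟩ := exists_nat_gt (2 / η)
  set L := 4 * Real.log (2 * R) / η ^ 2 + 1 with hLdef
  have hlog : 0 ≤ Real.log (2 * R) := Real.log_nonneg (by linarith)
  have hL : 0 < L := by positivity
  have hT := finite_integral_of_roots_le R N
  refine ⟨Real.exp (-L), Real.exp_pos _, #hT.toFinset, ?_⟩
  intro p hp hs hn hroots S hS hclose
  set Λ := (p.map (Int.castRingHom ℝ)).roots.toFinset with hΛ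
  have hp0 : p.map (Int.castRingHom ℝ) ≠ 0 := (hp.map _).ne_zero
  have hcard : #Λ = p.natDegree := by
    rw [hΛ, Multiset.toFinset_card_of_nodup hn, ← hs.natDegree_eq_card_roots, hp.natDegree_map]
  have hint : ∀ x ∈ Λ, IsIntegral ℤ x := fun x hx => by
    rw [hΛ, Multiset.mem_toFinset, mem_roots hp0, IsRoot, eval_map] at hx
    exact ⟨p, hp, hx⟩
  have hdvd : ∀ x ∈ Λ, minpoly ℤ x ∣ p := fun x hx => by
    refine minpoly.isIntegrallyClosed_dvd (hint x hx) ?_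
    rw [hΛ, Multiset.mem_toFinset, mem_roots hp0, IsRoot, eval_map] at hx
    exact hx
  have hle : ∀ x ∈ Λ, ((minpoly ℤ x).map (Int.castRingHom ℝ)).roots ≤
      (p.map (Int.castRingHom ℝ)).roots := fun x hx =>
    Polynomial.roots.le_of_dvd hp0 (Polynomial.map_dvd _ (hdvd x hx))
  have hspl : ∀ x ∈ Λ, ((minpoly ℤ x).map (Int.castRingHom ℝ)).Splits := fun x hx =>
    hs.of_dvd hp0 (Polynomial.map_dvd _ (hdvd x hx))
  have hroot : ∀ x ∈ Λ, x ∈ ((minpoly ℤ x).map (Int.castRingHom ℝ)).roots := fun x hx => by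
    rw [mem_roots ((minpoly.monic (hint x hx)).map _).ne_zero, IsRoot, eval_map]
    exact minpoly.aeval ℤ x
  -- Since `minpoly ℤ x` divides `p`, a conjugacy class inside `Λ` is the full root set of its
  -- minimal polynomial, so the discriminant bound applies to it.
  have hfib : ∀ x ∈ Λ, {y ∈ Λ | minpoly ℤ y = minpoly ℤ x} =
      ((minpoly ℤ x).map (Int.castRingHom ℝ)).roots.toFinset := by
    intro x hx
    ext y
    simp only [Finset.mem_filter, Multiset.mem_toFinset (a := y) (s := (map _ (minpoly ℤ x)).roots)]
    constructor
    · rintro ⟨hy, hyx⟩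
      rw [← hyx]; exact hroot y hy
    · intro hy
      have hyΛ : y ∈ Λ := by
        rw [hΛ, Multiset.mem_toFinset]; exact Multiset.mem_of_le (hle x hx) hy
      refine ⟨hyΛ, ?_⟩
      have h0 : aeval y (minpoly ℤ x) = 0 := by
        rw [mem_roots ((minpoly.monic (hint x hx)).map _).ne_zero, IsRoot, eval_map] at hy
        exact hy
      exact eq_of_monic_of_associated (minpoly.monic (hint y hyΛ)) (minpoly.monic (hint x hx))
        ((minpoly.irreducible (hint y hyΛ)).associated_of_dvd (minpoly.irreducible (hint x hx))
          (minpoly.isIntegrallyClosed_dvd (hint y hyΛ) h0))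
  have hclass : ∀ f ∈ Λ.image (minpoly ℤ), (#{x ∈ S \ hT.toFinset | minpoly ℤ x = f} : ℝ) ≤
      η * #{x ∈ Λ | minpoly ℤ x = f} := by
    intro f hf
    obtain ⟨x, hx, rfl⟩ := Finset.mem_image.1 hf
    rcases Finset.eq_empty_or_nonempty {y ∈ S \ hT.toFinset | minpoly ℤ y = minpoly ℤ x} with
      he | ⟨z, hz⟩
    · rw [he]; simp; positivity
    rw [Finset.mem_filter, Finset.mem_sdiff, Set.Finite.mem_toFinset] at hz
    have hdeg : N < (minpoly ℤ x).natDegree := by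
      by_contra hcon
      refine hz.1.2 ⟨minpoly ℤ x, minpoly.monic (hint x hx), not_lt.1 hcon, hspl x hx,
        fun y hy => hroots y (Multiset.mem_of_le (hle x hx) hy), ?_⟩
      rw [← hz.2]; exact hroot z (hS hz.1.1)
    have hnd : ((minpoly ℤ x).map (Int.castRingHom ℝ)).roots.Nodup :=
      Multiset.nodup_of_le (hle x hx) hn
    have hcK : #{y ∈ Λ | minpoly ℤ y = minpoly ℤ x} = (minpoly ℤ x).natDegree := by
      rw [hfib x hx, Multiset.toFinset_card_of_nodup hnd, ← (hspl x hx).natDegree_eq_card_roots,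
        (minpoly.monic (hint x hx)).natDegree_map]
    have hprod := one_le_prod_root_differences _ (minpoly.monic (hint x hx)) (hspl x hx) hnd
    rw [← hfib x hx] at hprod
    have hmain := card_le_of_prod_differences (a := η / 2) hR hL (by positivity) (by
        rw [hLdef]; field_simp; nlinarith [sq_nonneg η]) _
      {y ∈ S \ hT.toFinset | minpoly ℤ y = minpoly ℤ x} (by
        intro y hy
        rw [Finset.mem_filter, Finset.mem_sdiff] at hy
        exact Finset.mem_filter.2 ⟨hS hy.1.1, hy.2⟩)
      (fun y hy => hroots y (by simpa [hΛ] using (Finset.mem_filter.1 hy).1)) hprod (by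
        intro y hy y' hy'
        rw [Finset.mem_filter, Finset.mem_sdiff] at hy hy'
        refine hclose y hy.1.1 y' hy'.1.1 ?_
        rw [isConjRoot_def, minpoly.isIntegrallyClosed_eq_field_fractions' ℚ (hint y (hS hy.1.1)),
          minpoly.isIntegrallyClosed_eq_field_fractions' ℚ (hint y' (hS hy'.1.1)), hy.2, hy'.2])
    refine hmain.trans ?_
    have h1 : (N : ℝ) ≤ #{y ∈ Λ | minpoly ℤ y = minpoly ℤ x} := by
      rw [hcK]; exact_mod_cast hdeg.le
    have h2 : 1 ≤ η / 2 * N := by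
      rw [div_lt_iff₀ hη] at hN; linarith
    nlinarith
  have hsplit : #S ≤ #hT.toFinset + #(S \ hT.toFinset) := by
    have := Finset.card_le_card_sdiff_add_card (s := S) (t := hT.toFinset)
    omega
  have hS' : (#(S \ hT.toFinset) : ℝ) ≤ η * #Λ := by
    rw [Finset.card_eq_sum_card_fiberwise (f := minpoly ℤ) (s := S \ hT.toFinset)
      (t := Λ.image (minpoly ℤ)) (fun x hx => Finset.mem_image_of_mem _
        (hS (Finset.mem_sdiff.1 hx).1)),
      Finset.card_eq_sum_card_fiberwise (f := minpoly ℤ) (s := Λ)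
      (t := Λ.image (minpoly ℤ)) (fun x hx => Finset.mem_image_of_mem _ hx)]
    push_cast
    rw [Finset.mul_sum]
    exact Finset.sum_le_sum hclass
  rw [hcard] at hS'
  have : (#S : ℝ) ≤ #hT.toFinset + #(S \ hT.toFinset) := by exact_mod_cast hsplit
  linarith

end Conjugates

/-! ### Counting the eigenvalues near a point -/

section ApproximateEigenvectors

open Matrix

theorem sum_sq_of_disjoint {n : Type*} [Fintype n] {k : ℕ} (w : Fin k → n → ℝ) (hw : ∀ i j, i ≠ j → ∀ m, w i m * w j m = 0)
    (a : Fin k → ℝ) : ∑ m, (∑ i, a i * w i m) ^ 2 = ∑ i, a i ^ 2 * ∑ m, w i m ^ 2 := by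
  simp_rw [Finset.mul_sum]
  rw [Finset.sum_comm]
  refine Finset.sum_congr rfl fun m _ => ?_
  rw [sq, Finset.sum_mul_sum]
  refine Finset.sum_congr rfl fun i _ => ?_
  rw [Finset.sum_eq_single i]
  · ring
  · intro j _ hj
    have := hw i j hj.symm m
    linear_combination a i * a j * this
  · simp

variable {n : Type*} [Fintype n] [DecidableEq n] {A : Matrix n n ℝ}

theorem sum_sq_eq_sum_sq_dotProduct_eigenvector (hA : A.IsHermitian) (v : n → ℝ) :
    ∑ m, v m ^ 2 = ∑ j, ((hA.eigenvectorBasis j : n → ℝ) ⬝ᵥ v) ^ 2 := by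
  have h := hA.eigenvectorBasis.sum_sq_norm_inner_right (WithLp.toLp 2 v)
  rw [EuclideanSpace.real_norm_sq_eq] at h
  rw [← h]
  refine Finset.sum_congr rfl fun j _ => ?_
  rw [EuclideanSpace.inner_eq_star_dotProduct, Real.norm_eq_abs, sq_abs, dotProduct_comm]
  simp

theorem dotProduct_eigenvector_mulVec (hA : A.IsHermitian) (v : n → ℝ) (j : n) :
    (hA.eigenvectorBasis j : n → ℝ) ⬝ᵥ (A *ᵥ v) =
      hA.eigenvalues j * ((hA.eigenvectorBasis j : n → ℝ) ⬝ᵥ v) := by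
  have hT : Aᵀ = A := by simpa [conjTranspose_eq_transpose_of_trivial] using hA.eq
  rw [dotProduct_mulVec, ← mulVec_transpose, hT, hA.mulVec_eigenvectorBasis, smul_dotProduct,
    smul_eq_mul]

/-- Approximate eigenvectors with disjoint supports and disjointly supported residuals yield as
many eigenvalues. -/
theorem card_le_card_eigenvalues_near (hA : A.IsHermitian) {k : ℕ} (μ r : ℝ) (w : Fin k → n → ℝ)
    (hw0 : ∀ i, w i ≠ 0) (hw : ∀ i j, i ≠ j → ∀ m, w i m * w j m = 0)
    (hres : ∀ i j, i ≠ j → ∀ m, (A *ᵥ w i - μ • w i) m * (A *ᵥ w j - μ • w j) m = 0)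
    (hr : ∀ i, ∑ m, (A *ᵥ w i - μ • w i) m ^ 2 ≤ r ^ 2 * ∑ m, w i m ^ 2) (hr0 : 0 ≤ r) :
    k ≤ #{j | |hA.eigenvalues j - μ| ≤ r} := by
  by_contra hcon
  set I := ({j | |hA.eigenvalues j - μ| ≤ r} : Finset n) with hI
  -- With more vectors than nearby eigenvalues, some nontrivial combination of the `w i` is
  -- orthogonal to all eigenvectors belonging to `I`.
  let T : (Fin k → ℝ) →ₗ[ℝ] (I → ℝ) := LinearMap.pi fun j =>
    ∑ i, ((hA.eigenvectorBasis j : n → ℝ) ⬝ᵥ w i) • LinearMap.proj i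
  have hker : T.ker ≠ ⊥ := LinearMap.ker_ne_bot_of_finrank_lt (by simpa using hcon)
  obtain ⟨a, haT, ha⟩ := (Submodule.ne_bot_iff _).1 hker
  set v : n → ℝ := fun m => ∑ i, a i * w i m with hv
  have hvI : ∀ j ∈ I, (hA.eigenvectorBasis j : n → ℝ) ⬝ᵥ v = 0 := by
    intro j hj
    have h1 : T a ⟨j, hj⟩ = 0 := by rw [LinearMap.mem_ker.1 haT]; rfl
    simp only [T, LinearMap.pi_apply, LinearMap.sum_apply, LinearMap.smul_apply,
      LinearMap.proj_apply, smul_eq_mul] at h1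
    rw [← h1]
    simp only [hv, dotProduct, Finset.mul_sum, Finset.sum_mul]
    rw [Finset.sum_comm]
    exact Finset.sum_congr rfl fun i _ => Finset.sum_congr rfl fun m _ => by ring
  have hlin : A *ᵥ v - μ • v = fun m => ∑ i, a i * (A *ᵥ w i - μ • w i) m := by
    ext m
    simp only [Pi.sub_apply, Pi.smul_apply, smul_eq_mul, mul_sub, Finset.sum_sub_distrib, hv,
      mulVec, dotProduct, Finset.mul_sum]
    congr 1
    · rw [Finset.sum_comm]
      exact Finset.sum_congr rfl fun i _ => Finset.sum_congr rfl fun m _ => by ring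
    · exact Finset.sum_congr rfl fun m _ => by ring
  -- Both the vectors and the residuals are disjointly supported, so squared norms add and the
  -- combination inherits the residual bound.
  have hup : ∑ m, (A *ᵥ v - μ • v) m ^ 2 ≤ r ^ 2 * ∑ m, v m ^ 2 := by
    rw [hlin]
    simp only [hv]
    rw [sum_sq_of_disjoint _ hres a, sum_sq_of_disjoint _ hw a, Finset.mul_sum]
    refine Finset.sum_le_sum fun i _ => ?_
    nlinarith [mul_le_mul_of_nonneg_left (hr i) (sq_nonneg (a i))]
  have hvne : 0 < ∑ m, v m ^ 2 := by
    obtain ⟨i, hi⟩ := Function.ne_iff.1 ha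
    obtain ⟨m, hm⟩ := Function.ne_iff.1 (hw0 i)
    simp only [hv]
    rw [sum_sq_of_disjoint _ hw a]
    refine Finset.sum_pos' (fun i _ => by positivity) ⟨i, Finset.mem_univ _, ?_⟩
    have hm' : w i m ≠ 0 := hm
    have : 0 < ∑ m, w i m ^ 2 :=
      Finset.sum_pos' (fun _ _ => sq_nonneg _) ⟨m, Finset.mem_univ _, by positivity⟩
    have : a i ≠ 0 := hi
    positivity
  rw [sum_sq_eq_sum_sq_dotProduct_eigenvector hA, sum_sq_eq_sum_sq_dotProduct_eigenvector hA v,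
    Finset.mul_sum] at hup
  rw [sum_sq_eq_sum_sq_dotProduct_eigenvector hA v] at hvne
  obtain ⟨j, -, hj⟩ := Finset.exists_ne_zero_of_sum_ne_zero hvne.ne'
  -- All nonzero spectral components of `v` have `|eigenvalue - μ| > r`, which makes its residual
  -- strictly too large.
  refine absurd hup (not_le.2 (Finset.sum_lt_sum (fun l _ => ?_) ⟨j, Finset.mem_univ _, ?_⟩)) <;>
    rw [dotProduct_sub, dotProduct_eigenvector_mulVec, dotProduct_smul, smul_eq_mul, ← sub_mul,
      mul_pow]
  · by_cases hl : l ∈ I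
    · rw [hvI l hl]; simp
    · have : r ≤ |hA.eigenvalues l - μ| := by
        rw [hI, Finset.mem_filter] at hl
        exact (not_le.1 fun h => hl ⟨Finset.mem_univ _, h⟩).le
      have := pow_le_pow_left₀ hr0 this 2
      rw [sq_abs] at this
      gcongr
  · have hl : j ∉ I := fun h => hj (by rw [hvI j h]; simp)
    have : r < |hA.eigenvalues j - μ| := by
      rw [hI, Finset.mem_filter] at hl
      exact not_le.1 fun h => hl ⟨Finset.mem_univ _, h⟩
    have := pow_lt_pow_left₀ this hr0 two_ne_zero
    rw [sq_abs] at this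
    have h2 : 0 < ((hA.eigenvectorBasis j : n → ℝ) ⬝ᵥ v) ^ 2 := lt_of_le_of_ne (sq_nonneg _) hj.symm
    gcongr

end ApproximateEigenvectors

/-! ### Tridiagonal matrices with constant row sums -/

/-- The rows `(c_m, a_m, b_m)`, `0 ≤ m ≤ D`, of a tridiagonal matrix with constant row sums `κ`
whose lower entries increase and whose upper entries decrease. -/
structure MonotoneRows (κ : ℝ) (D : ℕ) (c a b : ℕ → ℝ) : Prop where
  c_zero : c 0 = 0
  a_zero : a 0 = 0
  b_zero : b 0 = κ
  c_one : c 1 = 1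
  b_last : b D = 0
  sum_eq : ∀ m ≤ D, c m + a m + b m = κ
  a_nonneg : ∀ m ≤ D, 0 ≤ a m
  one_le_c : ∀ m, 1 ≤ m → m ≤ D → 1 ≤ c m
  one_le_b : ∀ m < D, 1 ≤ b m
  c_mono : ∀ m m', m ≤ m' → m' ≤ D → c m ≤ c m'
  b_anti : ∀ m m', m ≤ m' → m' ≤ D → b m' ≤ b m
  one_le_D : 1 ≤ D
  one_le_κ : 1 ≤ κ

/-- Because `c 0 = 0` and `b n = 0`, the truncated index `m - 1` at `m = 0` and the value `z (n +
1)` are multiplied by zero, so one formula serves all rows. -/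
theorem triMatrix_mulVec {n : ℕ} {c a b : ℕ → ℝ} (hc : c 0 = 0) (hb : b n = 0) (z : ℕ → ℝ)
    (m : Fin (n + 1)) : (triMatrix n c a b).mulVec (fun i => z i) m =
      c m * z (m - 1) + a m * z m + b m * z (m + 1) := by
  obtain ⟨m, hm⟩ := m
  simp only [triMatrix, Matrix.mulVec, dotProduct, Matrix.of_apply]
  rw [Fin.sum_univ_eq_sum_range (fun j => (if j + 1 = m then c m else if j = m then a m else
    if j = m + 1 then b m else 0) * z j) (n + 1)]
  have hsplit : ∀ j ∈ range (n + 1), (if j + 1 = m then c m else if j = m then a m else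
      if j = m + 1 then b m else 0) * z j = (if j + 1 = m then c m * z j else 0) +
      (if j = m then a m * z j else 0) + (if j = m + 1 then b m * z j else 0) := by
    intro j _
    split_ifs <;> first | (exfalso; omega) | simp
  rw [sum_congr rfl hsplit, sum_add_distrib, sum_add_distrib]
  congr 1
  · congr 1
    · rcases Nat.eq_zero_or_pos m with h | h
      · subst h; simp [hc]
      · rw [sum_eq_single (m - 1)]
        · rw [if_pos (by omega)]
        · intro j _ hj; rw [if_neg (by omega)]
        · intro hj; exact absurd (mem_range.2 (by omega)) hj
    · rw [sum_ite_eq' (range (n + 1)) m, if_pos (mem_range.2 hm)]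
  · rw [sum_ite_eq' (range (n + 1)) (m + 1)]
    split_ifs with h
    · rfl
    · have : m = n := by rw [mem_range] at h; omega
      rw [this, hb, zero_mul]

namespace MonotoneRows

variable {κ : ℝ} {D : ℕ} {c a b : ℕ → ℝ} (R : MonotoneRows κ D c a b)
include R

theorem c_le {m : ℕ} (hm : m ≤ D) : c m ≤ κ := by
  have h1 := R.sum_eq m hm
  have h2 := R.a_nonneg m hm
  have h3 := R.b_anti m D hm le_rfl
  rw [R.b_last] at h3
  linarith

theorem c_nonneg {m : ℕ} (hm : m ≤ D) : 0 ≤ c m := by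
  have := R.c_mono 0 m (Nat.zero_le _) hm
  rwa [R.c_zero] at this

theorem b_nonneg {m : ℕ} (hm : m ≤ D) : 0 ≤ b m := by
  have := R.b_anti m D hm le_rfl
  rwa [R.b_last] at this

theorem b_le {m : ℕ} (hm : m ≤ D) : b m ≤ κ := by
  have := R.b_anti 0 m (Nat.zero_le _) hm
  rwa [R.b_zero] at this

/-- At `θ = κ` the constant row sums collapse the three-term recurrence to this detailed-balance
relation. It is what symmetrises the matrix and what makes the weighted estimates below telescope.
-/
theorem kappa_succ {m : ℕ} (hm : m < D) :
    kappa c a b (m + 1) * c (m + 1) = kappa c a b m * b m := by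
  induction m with
  | zero => simp [kappa, vPoly, R.c_one]
  | succ m ih =>
    have h1 := ih (by omega)
    have h2 := R.sum_eq (m + 1) hm.le
    have h3 : c (m + 2) ≠ 0 := by
      have := R.one_le_c (m + 2) (by omega) (by omega)
      positivity
    unfold kappa at *
    rw [vPoly, div_mul_cancel₀ _ h3, R.b_zero]
    rw [R.b_zero] at h1
    linear_combination h1 - vPoly c a b κ (m + 1) * h2

theorem kappa_pos {m : ℕ} (hm : m ≤ D) : 0 < kappa c a b m := by
  induction m with
  | zero => simp [kappa, vPoly]
  | succ m ih =>
    have h1 := ih (by omega)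
    have h2 := R.kappa_succ (m := m) (by omega)
    have h3 := R.one_le_c (m + 1) (by omega) hm
    have h4 := R.one_le_b m (by omega)
    have h5 : 0 < kappa c a b m * b m := by positivity
    rw [← h2] at h5
    exact pos_of_mul_pos_left h5 (by linarith)

end MonotoneRows

/-! ### Normalised solutions and Christoffel numbers -/

/-- The normalised solution `v_m(θ) / κ_m` of the three-term recurrence. -/
noncomputable def stdSeq (c a b : ℕ → ℝ) (θ : ℝ) (m : ℕ) : ℝ :=
  vPoly c a b θ m / kappa c a b m

theorem stdSeq_zero (c a b : ℕ → ℝ) (θ : ℝ) : stdSeq c a b θ 0 = 1 := by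
  simp [stdSeq, kappa, vPoly]

/-- The squared norm `∑ v_m(θ)² / κ_m`. -/
noncomputable def sqNorm (D : ℕ) (c a b : ℕ → ℝ) (θ : ℝ) : ℝ :=
  ∑ j ∈ range (D + 1), kappa c a b j * stdSeq c a b θ j ^ 2

namespace MonotoneRows

variable {κ : ℝ} {D : ℕ} {c a b : ℕ → ℝ} (R : MonotoneRows κ D c a b) (θ : ℝ)
include R

theorem stdSeq_one : κ * stdSeq c a b θ 1 = θ := by
  have := R.one_le_κ
  have h : κ ≠ 0 := by positivity
  simp only [stdSeq, kappa, vPoly, R.b_zero]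
  field_simp

/-- Division by `κ_m` turns the recurrence for `v_m` into an eigenvector row of the matrix. The
diagonal entry is eliminated through the row sum, so that only `κ - θ` enters. -/
theorem stdSeq_succ {m : ℕ} (hm : m + 1 < D) :
    b (m + 1) * stdSeq c a b θ (m + 2) =
      (b (m + 1) + c (m + 1) - (κ - θ)) * stdSeq c a b θ (m + 1) - c (m + 1) * stdSeq c a b θ m := by
  have k0 := R.kappa_succ (m := m) (by omega)
  have k1 := R.kappa_succ (m := m + 1) (by omega)
  have p0 := R.kappa_pos (m := m) (by omega)
  have p1 := R.kappa_pos (m := m + 1) (by omega)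
  have p2 := R.kappa_pos (m := m + 2) (by omega)
  have hs := R.sum_eq (m + 1) hm.le
  have hc2 := R.one_le_c (m + 2) (by omega) (by omega)
  have hc1 := R.one_le_c (m + 1) (by omega) (by omega)
  have hv : vPoly c a b θ (m + 2) * c (m + 2) =
      (θ - a (m + 1)) * vPoly c a b θ (m + 1) - b m * vPoly c a b θ m := by
    rw [vPoly, div_mul_cancel₀ _ (by positivity)]
  have ha : θ - a (m + 1) = b (m + 1) + c (m + 1) - (κ - θ) := by linarith
  rw [ha] at hv
  simp only [stdSeq]
  have e1 : b (m + 1) * (vPoly c a b θ (m + 2) / kappa c a b (m + 2)) =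
      vPoly c a b θ (m + 2) * c (m + 2) / kappa c a b (m + 1) := by
    rw [← mul_div_assoc, div_eq_div_iff p2.ne' p1.ne']
    linear_combination (-vPoly c a b θ (m + 2)) * k1
  have e2 : c (m + 1) * (vPoly c a b θ m / kappa c a b m) =
      b m * vPoly c a b θ m / kappa c a b (m + 1) := by
    rw [← mul_div_assoc, div_eq_div_iff p0.ne' p1.ne']
    linear_combination vPoly c a b θ m * k0
  rw [e1, e2, hv]
  ring

/-- Since `b m ≠ 0` for `m < D`, the rows before the last determine each entry from the earlier
ones, starting with `z 0`. -/
theorem eq_smul_stdSeq (z : ℕ → ℝ)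
    (hz : ∀ m < D, c m * z (m - 1) + a m * z m + b m * z (m + 1) = θ * z m) :
    ∀ m ≤ D, z m = z 0 * stdSeq c a b θ m := by
  intro m
  induction m using Nat.strong_induction_on with
  | _ m ih =>
    intro hm
    match m with
    | 0 => simp [stdSeq_zero]
    | 1 =>
      have h1 := hz 0 (by omega)
      rw [R.c_zero, R.a_zero, R.b_zero] at h1
      have h2 := R.stdSeq_one θ
      have h3 := R.one_le_κ
      have h4 : κ * z 1 = κ * (z 0 * stdSeq c a b θ 1) := by
        simp only [zero_mul, zero_add] at h1; linear_combination h1 - z 0 * h2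
      exact mul_left_cancel₀ (by positivity) h4
    | m + 2 =>
      have h0 := ih m (by omega) (by omega)
      have h1 := ih (m + 1) (by omega) (by omega)
      have h2 := hz (m + 1) (by omega)
      have h3 := R.stdSeq_succ θ (m := m) (by omega)
      have h4 := R.one_le_b (m + 1) (by omega)
      have hs := R.sum_eq (m + 1) (by omega)
      refine mul_left_cancel₀ (a := b (m + 1)) (by positivity) ?_
      simp only [Nat.add_sub_cancel] at h2
      rw [h0, h1] at h2
      linear_combination h2 - z 0 * h3 - z 0 * stdSeq c a b θ (m + 1) * hs

theorem sqNorm_pos : 0 < sqNorm D c a b θ := by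
  refine sum_pos' (fun j hj => ?_) ⟨0, by simp, ?_⟩
  · have := R.kappa_pos (m := j) (by rw [mem_range] at hj; omega)
    positivity
  · rw [stdSeq_zero]; have := R.kappa_pos (m := 0) (by omega); positivity

theorem christoffel_eq : christoffel D c a b θ =
    (∑ j ∈ range (D + 1), kappa c a b j) / sqNorm D c a b θ := by
  unfold christoffel sqNorm
  congr 1
  refine sum_congr rfl fun j hj => ?_
  have := R.kappa_pos (m := j) (by rw [mem_range] at hj; omega)
  simp only [stdSeq]
  field_simp

/-- The numerator of the Christoffel number does not depend on the eigenvalue. This is the form in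
which Property (AC) is used. -/
theorem sqNorm_eq_of_christoffel_eq {η : ℝ} (h : christoffel D c a b θ = christoffel D c a b η) :
    sqNorm D c a b θ = sqNorm D c a b η := by
  rw [R.christoffel_eq, R.christoffel_eq] at h
  have hs : 0 < ∑ j ∈ range (D + 1), kappa c a b j :=
    sum_pos (fun j hj => R.kappa_pos (by rw [mem_range] at hj; omega)) ⟨0, by simp⟩
  have h1 := R.sqNorm_pos θ
  have h2 := R.sqNorm_pos η
  rw [div_eq_div_iff h1.ne' h2.ne'] at h
  exact (mul_left_cancel₀ hs.ne' h).symm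

end MonotoneRows

/-! ### Symmetrisation and simplicity of the spectrum -/

/-- The symmetric tridiagonal matrix that is similar to `triMatrix D c a b`. -/
noncomputable def symMatrix (D : ℕ) (c a b : ℕ → ℝ) : Matrix (Fin (D + 1)) (Fin (D + 1)) ℝ :=
  triMatrix D (fun m => √(b (m - 1) * c m)) a (fun m => √(b m * c (m + 1)))

theorem symMatrix_isHermitian (D : ℕ) (c a b : ℕ → ℝ) : (symMatrix D c a b).IsHermitian := by
  refine Matrix.IsHermitian.ext fun i j => ?_
  simp only [symMatrix, triMatrix, Matrix.of_apply, star_trivial]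
  obtain ⟨i, hi⟩ := i
  obtain ⟨j, hj⟩ := j
  simp only
  rcases lt_trichotomy i j with h | h | h
  · by_cases h1 : i + 1 = j
    · subst h1
      simp; omega
    · rw [if_neg h1, if_neg (by omega), if_neg (by omega), if_neg (by omega), if_neg (by omega),
        if_neg (by omega)]
  · subst h; simp
  · by_cases h1 : j + 1 = i
    · subst h1
      simp; omega
    · rw [if_neg (by omega), if_neg (by omega), if_neg (by omega), if_neg (by omega),
        if_neg (by omega), if_neg (by omega)]

theorem hasEigenvalue_iff_mem_roots {D : ℕ} {c a b : ℕ → ℝ} {θ : ℝ} :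
    Module.End.HasEigenvalue (Matrix.toLin' (triMatrix D c a b)) θ ↔
      θ ∈ (triMatrix D c a b).charpoly.roots := by
  rw [Module.End.hasEigenvalue_iff_isRoot_charpoly, Matrix.charpoly_toLin',
    Polynomial.mem_roots (Matrix.charpoly_monic _).ne_zero]

namespace MonotoneRows

variable {κ : ℝ} {D : ℕ} {c a b : ℕ → ℝ} (R : MonotoneRows κ D c a b)
include R

theorem sqrt_kappa_mul_c {m : ℕ} (hm : m < D) :
    √(b m * c (m + 1)) * √(kappa c a b m) = √(kappa c a b (m + 1)) * c (m + 1) := by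
  have p0 := R.kappa_pos (m := m) (by omega)
  have p1 := R.kappa_pos (m := m + 1) (by omega)
  have hc := R.one_le_c (m + 1) (by omega) (by omega)
  have hb := R.one_le_b m hm
  have k := R.kappa_succ hm
  rw [← Real.sqrt_mul (by positivity)]
  conv_rhs => rw [← Real.sqrt_sq (show (0 : ℝ) ≤ c (m + 1) by linarith)]
  rw [← Real.sqrt_mul p1.le]
  congr 1
  linear_combination (-c (m + 1)) * k

theorem sqrt_kappa_mul_b {m : ℕ} (hm : m < D) :
    √(b m * c (m + 1)) * √(kappa c a b (m + 1)) = √(kappa c a b m) * b m := by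
  have p0 := R.kappa_pos (m := m) (by omega)
  have p1 := R.kappa_pos (m := m + 1) (by omega)
  have hc := R.one_le_c (m + 1) (by omega) (by omega)
  have hb := R.one_le_b m hm
  have k := R.kappa_succ hm
  rw [← Real.sqrt_mul (by positivity)]
  conv_rhs => rw [← Real.sqrt_sq (show (0 : ℝ) ≤ b m by linarith)]
  rw [← Real.sqrt_mul p0.le]
  congr 1
  linear_combination b m * k

/-- The similarity is conjugation by `diag √κ_m`; off the diagonal the two sides agree by detailed
balance. -/
theorem symMatrix_mul_diagonal :
    symMatrix D c a b * Matrix.diagonal (fun i : Fin (D + 1) => √(kappa c a b i)) =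
      Matrix.diagonal (fun i : Fin (D + 1) => √(kappa c a b i)) * triMatrix D c a b := by
  ext ⟨i, hi⟩ ⟨j, hj⟩
  rw [Matrix.mul_diagonal, Matrix.diagonal_mul]
  simp only [symMatrix, triMatrix, Matrix.of_apply]
  by_cases h1 : j + 1 = i
  · subst h1
    rw [if_pos rfl, if_pos rfl, Nat.add_sub_cancel]
    exact R.sqrt_kappa_mul_c (by omega)
  rw [if_neg h1, if_neg h1]
  by_cases h2 : j = i
  · subst h2
    rw [if_pos rfl, if_pos rfl, mul_comm]
  rw [if_neg h2, if_neg h2]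
  by_cases h3 : j = i + 1
  · subst h3
    rw [if_pos rfl, if_pos rfl]
    exact R.sqrt_kappa_mul_b (by omega)
  · rw [if_neg h3, if_neg h3]; simp

theorem sqrt_kappa_pos (i : Fin (D + 1)) : 0 < √(kappa c a b i) :=
  Real.sqrt_pos.2 (R.kappa_pos (by omega))

theorem charpoly_symMatrix : (symMatrix D c a b).charpoly = (triMatrix D c a b).charpoly := by
  set P := Matrix.diagonal (fun i : Fin (D + 1) => √(kappa c a b i)) with hP
  set Q := Matrix.diagonal (fun i : Fin (D + 1) => (√(kappa c a b i))⁻¹) with hQ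
  have hPQ : P * Q = 1 := by
    rw [hP, hQ, Matrix.diagonal_mul_diagonal, ← Matrix.diagonal_one]
    congr 1
    ext i
    exact mul_inv_cancel₀ (R.sqrt_kappa_pos i).ne'
  have hQP : Q * P = 1 := by
    rw [hP, hQ, Matrix.diagonal_mul_diagonal, ← Matrix.diagonal_one]
    congr 1
    ext i
    exact inv_mul_cancel₀ (R.sqrt_kappa_pos i).ne'
  have h : symMatrix D c a b = P * (triMatrix D c a b * Q) := by
    rw [← mul_assoc, ← R.symMatrix_mul_diagonal, mul_assoc, hPQ, mul_one]
  rw [h, Matrix.charpoly_mul_comm, mul_assoc, hQP, mul_one]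

/-- The rows before the last force the shape of the eigenvector, and the last row leaves the end
condition. It is stated with the factor `t`, which is cancelled once the vector is known to be
nonzero. -/
theorem eigenvector_eq (θ : ℝ) (y : Fin (D + 1) → ℝ)
    (hy : (triMatrix D c a b).mulVec y = θ • y) :
    ∃ t : ℝ, (∀ i : Fin (D + 1), y i = t * stdSeq c a b θ i) ∧
      t * (c D * stdSeq c a b θ (D - 1)) = t * ((c D - (κ - θ)) * stdSeq c a b θ D) := by
  set z : ℕ → ℝ := fun m => if h : m < D + 1 then y ⟨m, h⟩ else 0 with hz
  have hzy : (fun i : Fin (D + 1) => z i) = y := by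
    ext i
    exact dif_pos i.isLt
  have hrow : ∀ m ≤ D, c m * z (m - 1) + a m * z m + b m * z (m + 1) = θ * z m := by
    intro m hm
    have h := triMatrix_mulVec (a := a) R.c_zero R.b_last z ⟨m, by omega⟩
    rw [hzy, hy] at h
    rw [← h, ← hzy]; rfl
  have hsol := R.eq_smul_stdSeq θ z fun m hm => hrow m hm.le
  refine ⟨z 0, fun i => ?_, ?_⟩
  · rw [← hsol i (by omega), ← hzy]
  · have h := hrow D le_rfl
    have hs := R.sum_eq D le_rfl
    rw [R.b_last, hsol D le_rfl, hsol (D - 1) (by omega)] at h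
    rw [R.b_last] at hs
    linear_combination h - z 0 * stdSeq c a b θ D * hs

theorem last_row_of_hasEigenvalue {θ : ℝ}
    (h : Module.End.HasEigenvalue (Matrix.toLin' (triMatrix D c a b)) θ) :
    c D * stdSeq c a b θ (D - 1) = (c D - (κ - θ)) * stdSeq c a b θ D := by
  obtain ⟨y, hy⟩ := h.exists_hasEigenvector
  have h1 := hy.apply_eq_smul
  rw [Matrix.toLin'_apply] at h1
  obtain ⟨t, ht, hl⟩ := R.eigenvector_eq θ y h1
  have ht0 : t ≠ 0 := by
    rintro rfl
    exact hy.2 (funext fun i => by simp [ht i])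
  exact mul_left_cancel₀ ht0 hl

/-- Gershgorin: the entries of each row are nonnegative and sum to `κ`. -/
theorem abs_le_of_hasEigenvalue {θ : ℝ}
    (h : Module.End.HasEigenvalue (Matrix.toLin' (triMatrix D c a b)) θ) : |θ| ≤ κ := by
  obtain ⟨k, hk⟩ := eigenvalue_mem_ball h
  rw [mem_closedBall_iff_norm, Real.norm_eq_abs] at hk
  have hnn : ∀ j, 0 ≤ triMatrix D c a b k j := fun j => by
    simp only [triMatrix, Matrix.of_apply]
    split_ifs
    · exact R.c_nonneg (by omega)
    · exact R.a_nonneg _ (by omega)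
    · exact R.b_nonneg (by omega)
    · exact le_rfl
  have hsum : ∑ j, triMatrix D c a b k j = κ := by
    have h1 := triMatrix_mulVec (a := a) R.c_zero R.b_last (fun _ => 1) k
    simp only [Matrix.mulVec, dotProduct, mul_one] at h1
    rw [h1, R.sum_eq k (by omega)]
  rw [← Finset.add_sum_erase _ _ (mem_univ k)] at hsum
  have h2 : ∑ j ∈ univ.erase k, ‖triMatrix D c a b k j‖ = ∑ j ∈ univ.erase k, triMatrix D c a b k j :=
    sum_congr rfl fun j _ => by rw [Real.norm_eq_abs, abs_of_nonneg (hnn j)]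
  rw [h2] at hk
  have h3 := hnn k
  rw [abs_le] at hk ⊢
  constructor <;> linarith [hk.1, hk.2]

theorem roots_charpoly : (triMatrix D c a b).charpoly.roots =
    Multiset.map (symMatrix_isHermitian D c a b).eigenvalues univ.val := by
  rw [← R.charpoly_symMatrix, (symMatrix_isHermitian D c a b).roots_charpoly_eq_eigenvalues]
  rfl

theorem splits_charpoly : (triMatrix D c a b).charpoly.Splits := by
  rw [← R.charpoly_symMatrix]
  exact (symMatrix_isHermitian D c a b).splits_charpoly

/-- Two orthonormal eigenvectors with the same eigenvalue would both be multiples of the single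
nonzero vector `√κ_m · stdSeq`, and could not be orthogonal. -/
theorem eigenvalues_injective :
    Function.Injective (symMatrix_isHermitian D c a b).eigenvalues := by
  set hA := symMatrix_isHermitian D c a b with hAdef
  intro i j hij
  by_contra hne
  have key : ∀ l, ∃ t : ℝ, ∀ m : Fin (D + 1), hA.eigenvectorBasis l m =
      t * (√(kappa c a b m) * stdSeq c a b (hA.eigenvalues l) m) := by
    intro l
    set e : Fin (D + 1) → ℝ := ⇑(hA.eigenvectorBasis l) with he
    set y : Fin (D + 1) → ℝ := fun m => (√(kappa c a b m))⁻¹ * e m with hy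
    have hey : e = (Matrix.diagonal (fun i : Fin (D + 1) => √(kappa c a b i))).mulVec y := by
      ext m
      rw [Matrix.mulVec_diagonal, hy, mul_inv_cancel_left₀ (R.sqrt_kappa_pos m).ne']
    have h1 := hA.mulVec_eigenvectorBasis l
    rw [← he] at h1
    have h2 : (triMatrix D c a b).mulVec y = hA.eigenvalues l • y := by
      have h3 : (Matrix.diagonal (fun i : Fin (D + 1) => √(kappa c a b i))).mulVec
          ((triMatrix D c a b).mulVec y) = hA.eigenvalues l • e := by
        rw [Matrix.mulVec_mulVec, ← R.symMatrix_mul_diagonal, ← Matrix.mulVec_mulVec, ← hey, h1]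
      ext m
      have h4 := congrFun h3 m
      rw [Matrix.mulVec_diagonal] at h4
      simp only [Pi.smul_apply, smul_eq_mul, hy] at h4 ⊢
      rw [mul_left_comm, ← h4, inv_mul_cancel_left₀ (R.sqrt_kappa_pos m).ne']
    obtain ⟨t, ht, -⟩ := R.eigenvector_eq _ y h2
    refine ⟨t, fun m => ?_⟩
    change e m = _
    rw [hey, Matrix.mulVec_diagonal, ht m]
    ring
  obtain ⟨s, hs⟩ := key i
  obtain ⟨t, ht⟩ := key j
  rw [← hij] at ht
  have horth : inner ℝ (hA.eigenvectorBasis i) (hA.eigenvectorBasis j) = 0 :=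
    hA.eigenvectorBasis.orthonormal.2 hne
  rw [EuclideanSpace.inner_eq_star_dotProduct] at horth
  simp only [star_trivial, dotProduct, ht, hs] at horth
  have h0 : s * t * ∑ m : Fin (D + 1),
      (√(kappa c a b m) * stdSeq c a b (hA.eigenvalues i) m) ^ 2 = 0 := by
    rw [← horth, mul_sum]
    exact sum_congr rfl fun m _ => by ring
  have hpos : 0 < ∑ m : Fin (D + 1),
      (√(kappa c a b m) * stdSeq c a b (hA.eigenvalues i) m) ^ 2 := by
    refine sum_pos' (fun _ _ => sq_nonneg _) ⟨0, mem_univ _, ?_⟩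
    have := R.sqrt_kappa_pos 0
    simp only [Fin.val_zero, stdSeq_zero] at this ⊢
    positivity
  have hst : s * t = 0 := (mul_eq_zero.1 h0).resolve_right hpos.ne'
  have hunit : ∀ l, hA.eigenvectorBasis l ≠ 0 := fun l => hA.eigenvectorBasis.orthonormal.ne_zero l
  rcases mul_eq_zero.1 hst with h | h
  · exact hunit i (by ext m; rw [hs m, h]; simp)
  · exact hunit j (by ext m; rw [ht m, h]; simp)

theorem nodup_roots : (triMatrix D c a b).charpoly.roots.Nodup := by
  rw [R.roots_charpoly]
  exact Multiset.Nodup.map R.eigenvalues_injective univ.nodup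

end MonotoneRows

/-- A tridiagonal matrix with integer entries has an integral characteristic polynomial. -/
theorem exists_int_charpoly (D : ℕ) (c a b : ℕ → ℝ) (hc : ∀ m, ∃ k : ℕ, c m = k)
    (ha : ∀ m, ∃ k : ℕ, a m = k) (hb : ∀ m, ∃ k : ℕ, b m = k) :
    ∃ p : Polynomial ℤ, p.Monic ∧ p.natDegree = D + 1 ∧
      p.map (Int.castRingHom ℝ) = (triMatrix D c a b).charpoly := by
  choose c' hc' using hc
  choose a' ha' using ha
  choose b' hb' using hb
  set Z : Matrix (Fin (D + 1)) (Fin (D + 1)) ℤ := Matrix.of fun i j =>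
    if (j : ℕ) + 1 = i then (c' i : ℤ)
    else if (j : ℕ) = i then (a' i : ℤ)
    else if (j : ℕ) = i + 1 then (b' i : ℤ)
    else 0 with hZ
  refine ⟨Z.charpoly, Matrix.charpoly_monic _, by simp [Matrix.charpoly_natDegree_eq_dim], ?_⟩
  rw [← Matrix.charpoly_map]
  congr 1
  ext i j
  simp only [hZ, triMatrix, Matrix.map_apply, Matrix.of_apply, hc', ha', hb']
  split_ifs <;> simp

/-! ### Chebyshev windows and eigenvalues produced by a long block -/

/-- The solution of `U_{j+1} = 2 t U_j - U_{j-1}` with `U_0 = 0`, `U_1 = 1`. -/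
def chebSeq (t : ℝ) : ℕ → ℝ
  | 0 => 0
  | 1 => 1
  | j + 2 => 2 * t * chebSeq t (j + 1) - chebSeq t j

/-- The recursion preserves this quadratic form. For `|t| < 1` the form is positive definite, which
bounds the sum of two consecutive squares from both sides. -/
theorem chebSeq_invariant (t : ℝ) (j : ℕ) :
    chebSeq t j ^ 2 - 2 * t * chebSeq t j * chebSeq t (j + 1) + chebSeq t (j + 1) ^ 2 = 1 := by
  induction j with
  | zero => simp [chebSeq]
  | succ j ih => rw [chebSeq]; linear_combination ih

theorem chebSeq_sq_add_le {t : ℝ} (ht : |t| < 1) (j : ℕ) :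
    chebSeq t j ^ 2 + chebSeq t (j + 1) ^ 2 ≤ 1 / (1 - |t|) := by
  have h := chebSeq_invariant t j
  rw [le_div_iff₀ (by linarith)]
  rcases abs_cases t with ⟨h1, h2⟩ | ⟨h1, h2⟩ <;> rw [h1] <;>
    nlinarith [sq_nonneg (chebSeq t j - chebSeq t (j + 1)),
      sq_nonneg (chebSeq t j + chebSeq t (j + 1))]

theorem le_chebSeq_sq_add {t : ℝ} (ht : |t| < 1) (j : ℕ) :
    1 / 2 ≤ chebSeq t j ^ 2 + chebSeq t (j + 1) ^ 2 := by
  have h := chebSeq_invariant t j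
  have h2 := abs_lt.1 ht
  nlinarith [sq_nonneg (chebSeq t j - chebSeq t (j + 1)),
      sq_nonneg (chebSeq t j + chebSeq t (j + 1))]

/-- The lower bounds for the `N` consecutive pairs are added; each square is counted at most twice.
-/
theorem le_sum_chebSeq_sq {t : ℝ} (ht : |t| < 1) (N : ℕ) :
    (N : ℝ) / 4 ≤ ∑ j ∈ range (N + 1), chebSeq t j ^ 2 := by
  have h : ∀ N : ℕ, (N : ℝ) / 2 + chebSeq t N ^ 2 ≤ 2 * ∑ j ∈ range (N + 1), chebSeq t j ^ 2 := by
    intro N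
    induction N with
    | zero => simp [chebSeq]
    | succ N ih =>
      rw [sum_range_succ]
      have := le_chebSeq_sq_add ht N
      push_cast
      linarith
  have := h N
  nlinarith [sq_nonneg (chebSeq t N)]

/-- The sequence `chebSeq t`, moved to the positions `T, …, T + N` and extended by `0`. -/
noncomputable def window (t : ℝ) (N T m : ℕ) : ℝ :=
  if T ≤ m ∧ m ≤ T + N then chebSeq t (m - T) else 0

theorem window_add {t : ℝ} {N T j : ℕ} (hj : j ≤ N) : window t N T (T + j) = chebSeq t j := by
  rw [window, if_pos (by omega), Nat.add_sub_cancel_left]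

/-- The position `m = T` is included because `chebSeq t 0 = 0`; the left end of a window therefore
costs only the residual `q` in row `T`. -/
theorem window_eq_zero {t : ℝ} {N T m : ℕ} (h : m ≤ T ∨ T + N < m) : window t N T m = 0 := by
  rw [window]
  split_ifs with h1
  · have : m - T = 0 := by omega
    rw [this, chebSeq]
  · rfl

theorem sum_window_sq (t : ℝ) (N T n : ℕ) (h : T + N ≤ n) :
    ∑ m ∈ range (n + 1), window t N T m ^ 2 = ∑ j ∈ range (N + 1), chebSeq t j ^ 2 := by
  have h1 : (range (N + 1)).map (addLeftEmbedding T) ⊆ range (n + 1) := by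
    intro m hm
    simp only [mem_map, mem_range, addLeftEmbedding_apply] at hm ⊢
    obtain ⟨j, hj, rfl⟩ := hm
    omega
  rw [← sum_subset h1]
  · rw [sum_map]
    refine sum_congr rfl fun j hj => ?_
    rw [addLeftEmbedding_apply, window_add (by rw [mem_range] at hj; omega)]
  · intro m _ hm
    rw [window_eq_zero, zero_pow two_ne_zero]
    by_contra hcon
    push Not at hcon
    refine hm ?_
    simp only [mem_map, mem_range, addLeftEmbedding_apply]
    exact ⟨m - T, by omega, by omega⟩

/-- The residual of a window as an approximate solution of a recurrence with constant
coefficients. -/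
theorem window_residual {N T : ℕ} (hT : 1 ≤ T) (hN : 1 ≤ N) (t q α : ℝ) (c a b : ℕ → ℝ)
    (hc : ∀ m, T + 1 ≤ m → m ≤ T + N + 1 → c m = q) (hb : ∀ m, T ≤ m → m ≤ T + N → b m = q)
    (ha : ∀ m, T ≤ m → m ≤ T + N → a m = α) (m : ℕ) :
    c m * window t N T (m - 1) + a m * window t N T m + b m * window t N T (m + 1)
        - (α + 2 * t * q) * window t N T m =
      (if m = T then q else 0) + (if m = T + N then -(q * chebSeq t (N + 1)) else 0) +
        (if m = T + N + 1 then q * chebSeq t N else 0) := by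
  -- Only three rows fail the recurrence: row `T` sees `chebSeq t 1 = 1` without a predecessor, row
  -- `T + N` misses its successor, and row `T + N + 1` still sees the last entry.
  rcases Nat.lt_or_ge m T with h | h
  · rw [window_eq_zero (m := m - 1) (by omega), window_eq_zero (m := m) (by omega),
      window_eq_zero (m := m + 1) (by omega), if_neg (by omega), if_neg (by omega),
      if_neg (by omega)]
    ring
  obtain ⟨j, rfl⟩ := Nat.exists_eq_add_of_le h
  rcases Nat.lt_or_ge N j with hj | hj
  · rcases Nat.lt_or_ge (N + 1) j with hj' | hj'
    · rw [window_eq_zero (m := T + j - 1) (by omega), window_eq_zero (m := T + j) (by omega),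
        window_eq_zero (m := T + j + 1) (by omega), if_neg (by omega), if_neg (by omega),
        if_neg (by omega)]
      ring
    · obtain rfl : j = N + 1 := by omega
      rw [show T + (N + 1) - 1 = T + N by omega, window_add le_rfl,
        window_eq_zero (m := T + (N + 1)) (by omega),
        window_eq_zero (m := T + (N + 1) + 1) (by omega), if_neg (by omega), if_neg (by omega),
        if_pos (by omega), hc _ (by omega) (by omega)]
      ring
  · rw [hb _ (by omega) (by omega), ha _ (by omega) (by omega), window_add hj,
      if_neg (show ¬ T + j = T + N + 1 by omega)]
    match j with
    | 0 =>
      rw [window_eq_zero (m := T + 0 - 1) (by omega), show T + 0 + 1 = T + 1 from rfl, window_add hN,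
        if_pos (by omega), if_neg (by omega)]
      simp [chebSeq]
    | j + 1 =>
      rw [show T + (j + 1) - 1 = T + j by omega, window_add (by omega),
        hc _ (by omega) (by omega), if_neg (by omega)]
      rcases Nat.lt_or_ge (j + 1) N with h1 | h1
      · rw [show T + (j + 1) + 1 = T + (j + 2) by omega, window_add (by omega), if_neg (by omega),
          chebSeq]
        ring
      · obtain rfl : N = j + 1 := by omega
        rw [window_eq_zero (m := T + (j + 1) + 1) (by omega), if_pos rfl, chebSeq]
        ring

namespace MonotoneRows

variable {κ : ℝ} {D : ℕ} {c a b : ℕ → ℝ} (R : MonotoneRows κ D c a b)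
include R

/-- A long block of constant rows produces many eigenvalues near every inner point of its
spectral interval. -/
theorem le_card_eigenvalues_of_block {s n N k : ℕ} (hs : 1 ≤ s) (hn : s + n ≤ D) {β γ t r : ℝ}
    (hblock : ∀ m, s ≤ m → m < s + n → b m = β ∧ c m = γ) (hβγ : 0 ≤ β * γ) (ht : |t| < 1)
    (hr : 0 ≤ r) (hN : 1 ≤ N) (hres : 4 * (β * γ) * (1 + 1 / (1 - |t|)) ≤ r ^ 2 * N)
    (hk : k * (N + 2) ≤ n) :
    k ≤ #{j | |(symMatrix_isHermitian D c a b).eigenvalues j -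
      (κ - β - γ + 2 * t * √(β * γ))| ≤ r} := by
  set q := √(β * γ) with hq
  -- A window together with its residual occupies the `N + 2` rows `T, …, T + N + 1`, so this
  -- spacing makes both disjoint.
  set T : Fin k → ℕ := fun i => s + i * (N + 2) with hT
  have hTs : ∀ i, s ≤ T i := fun i => by simp [hT]
  have hTn : ∀ i, T i + N + 2 ≤ s + n := fun i => by
    have h1 : ((i : ℕ) + 1) * (N + 2) ≤ k * (N + 2) := Nat.mul_le_mul_right _ i.isLt
    simp only [hT]
    nlinarith
  have hTd : ∀ i j, i ≠ j → T i + N + 2 ≤ T j ∨ T j + N + 2 ≤ T i := fun i j hij => by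
    have h0 : (i : ℕ) ≠ j := fun h => hij (Fin.ext h)
    simp only [hT]
    rcases lt_or_gt_of_ne h0 with h | h
    · left
      have h1 : ((i : ℕ) + 1) * (N + 2) ≤ j * (N + 2) := Nat.mul_le_mul_right _ h
      nlinarith
    · right
      have h1 : ((j : ℕ) + 1) * (N + 2) ≤ i * (N + 2) := Nat.mul_le_mul_right _ h
      nlinarith
  set ρ : Fin k → ℕ → ℝ := fun i m => (if m = T i then q else 0) +
    (if m = T i + N then -(q * chebSeq t (N + 1)) else 0) +
    (if m = T i + N + 1 then q * chebSeq t N else 0) with hρ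
  have hA : ∀ i, (symMatrix D c a b).mulVec (fun m => window t N (T i) m) -
      (κ - β - γ + 2 * t * q) • (fun m : Fin (D + 1) => window t N (T i) m) =
      fun m : Fin (D + 1) => ρ i m := by
    intro i
    have h1 := hTs i
    have h2 := hTn i
    ext m
    simp only [Pi.sub_apply, Pi.smul_apply, smul_eq_mul, symMatrix]
    rw [triMatrix_mulVec (by simp [R.c_zero]) (by simp [R.b_last])]
    refine window_residual (T := T i) (by omega) hN t q (κ - β - γ)
      (fun m => √(b (m - 1) * c m)) a (fun m => √(b m * c (m + 1))) ?_ ?_ ?_ m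
    · intro m hm hm'
      rw [(hblock (m - 1) (by omega) (by omega)).1, (hblock m (by omega) (by omega)).2]
    · intro m hm hm'
      rw [(hblock m (by omega) (by omega)).1, (hblock (m + 1) (by omega) (by omega)).2]
    · intro m hm hm'
      have := R.sum_eq m (by omega)
      rw [(hblock m (by omega) (by omega)).1, (hblock m (by omega) (by omega)).2] at this
      linarith
  have hsumw : ∀ i, ∑ m : Fin (D + 1), window t N (T i) m ^ 2 =
      ∑ j ∈ range (N + 1), chebSeq t j ^ 2 := fun i => by
    rw [Fin.sum_univ_eq_sum_range (fun m => window t N (T i) m ^ 2) (D + 1)]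
    exact sum_window_sq t N _ D (by have := hTn i; omega)
  have hNpos : (0 : ℝ) < N := by exact_mod_cast hN
  refine card_le_card_eigenvalues_near _ _ r (fun i m => window t N (T i) m) ?_ ?_ ?_ ?_ hr
  · intro i h
    have h1 := hsumw i
    have h2 := le_sum_chebSeq_sq ht N
    rw [← h1] at h2
    have h3 : ∀ m : Fin (D + 1), window t N (T i) m = 0 := fun m => congrFun h m
    simp only [h3] at h2
    norm_num at h2
    linarith
  · intro i j hij m
    rcases hTd i j hij with h | h
    · by_cases hm : (m : ℕ) ≤ T j
      · rw [window_eq_zero (T := T j) (Or.inl hm), mul_zero]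
      · rw [window_eq_zero (T := T i) (by omega), zero_mul]
    · by_cases hm : (m : ℕ) ≤ T i
      · rw [window_eq_zero (T := T i) (Or.inl hm), zero_mul]
      · rw [window_eq_zero (T := T j) (by omega), mul_zero]
  · intro i j hij m
    rw [hA i, hA j]
    change ρ i m * ρ j m = 0
    have hzero : ∀ i, ((m : ℕ) < T i ∨ T i + N + 2 ≤ m) → ρ i m = 0 := fun i h => by
      simp only [hρ]
      rw [if_neg (by omega), if_neg (by omega), if_neg (by omega)]
      simp
    rcases hTd i j hij with h | h
    · by_cases hm : (m : ℕ) < T j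
      · rw [hzero j (Or.inl hm), mul_zero]
      · rw [hzero i (by omega), zero_mul]
    · by_cases hm : (m : ℕ) < T i
      · rw [hzero i (Or.inl hm), zero_mul]
      · rw [hzero j (by omega), mul_zero]
  · intro i
    have h2 := hTn i
    rw [hA i, hsumw i]
    rw [Fin.sum_univ_eq_sum_range (fun m => ρ i m ^ 2) (D + 1)]
    have hsq : ∀ m ∈ range (D + 1), ρ i m ^ 2 = (if m = T i then q ^ 2 else 0) +
        (if m = T i + N then q ^ 2 * chebSeq t (N + 1) ^ 2 else 0) +
        (if m = T i + N + 1 then q ^ 2 * chebSeq t N ^ 2 else 0) := by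
      intro m _
      simp only [hρ]
      split_ifs <;> first | (exfalso; omega) | ring
    rw [sum_congr rfl hsq, sum_add_distrib, sum_add_distrib, sum_ite_eq', sum_ite_eq', sum_ite_eq',
      if_pos (mem_range.2 (by omega)), if_pos (mem_range.2 (by omega)),
      if_pos (mem_range.2 (by omega))]
    have hq2 : q ^ 2 = β * γ := Real.sq_sqrt hβγ
    have h3 := chebSeq_sq_add_le ht N
    have h4 := le_sum_chebSeq_sq ht N
    -- The residual has squared norm at most `βγ (1 + 1 / (1 - |t|))`, independently of `N`, while
    -- the window has squared norm at least `N / 4`; this is the source of the 4 in `hres`.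
    calc _ = q ^ 2 * (1 + (chebSeq t N ^ 2 + chebSeq t (N + 1) ^ 2)) := by ring
      _ ≤ q ^ 2 * (1 + 1 / (1 - |t|)) := by gcongr
      _ ≤ r ^ 2 * (N / 4) := by rw [hq2]; linarith
      _ ≤ _ := by gcongr

end MonotoneRows

/-! ### Growth of solutions of the three-term recurrence -/

/-- Growth of a solution of a three-term recurrence outside of the spectral interval of the last
of the rows considered. -/
theorem ratio_le_of_recurrence {s p q : ℝ} (hs : 0 ≤ s) (hp : 0 < p) (hq : 0 ≤ q)
    (hpq : s ≤ p - q) {b c x : ℕ → ℝ} {M : ℕ} (hb : ∀ m ≤ M, p ^ 2 ≤ b m)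
    (hc : ∀ m ≤ M, c m ≤ q ^ 2) (hc0 : ∀ m ≤ M, 0 ≤ c m) (hq' : 1 ≤ M → 0 < q) (hx : 0 ≤ x 0)
    (h0 : b 0 * x 1 = (b 0 - s ^ 2) * x 0)
    (h : ∀ m, m + 1 ≤ M →
      b (m + 1) * x (m + 2) = (b (m + 1) + c (m + 1) - s ^ 2) * x (m + 1) - c (m + 1) * x m) :
    ∀ m ≤ M, 0 ≤ x m ∧ q * x m ≤ p * x (m + 1) := by
  -- For `b = p²`, `c = q²`, `s = p - q` the characteristic equation is `(p z - q)² = 0`, so `q / p`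
  -- is the critical ratio. Larger `b`, smaller `c` or smaller `s` only raises the ratio of
  -- consecutive terms.
  intro m
  induction m with
  | zero =>
    intro _
    refine ⟨hx, ?_⟩
    have hb0 := hb 0 (Nat.zero_le _)
    have hbpos : 0 < b 0 := lt_of_lt_of_le (by positivity) hb0
    refine le_of_mul_le_mul_left ?_ hbpos
    have h1 : b 0 * q ≤ p * (b 0 - s ^ 2) := by
      have h2 : p ^ 2 * s ≤ b 0 * (p - q) := mul_le_mul hb0 hpq hs hbpos.le
      have h3 : s ^ 2 * p ≤ p ^ 2 * s := by
        have : s * (s * p) ≤ p * (s * p) :=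
          mul_le_mul_of_nonneg_right (by linarith) (by positivity)
        nlinarith
      linarith
    have h4 := mul_le_mul_of_nonneg_right h1 hx
    linear_combination h4 - p * h0
  | succ m ih =>
    intro hm
    obtain ⟨hx0, hx1⟩ := ih (by omega)
    have hqp := hq' (by omega)
    have hb1 := hb (m + 1) hm
    have hc1 := hc (m + 1) hm
    have hc01 := hc0 (m + 1) hm
    have hbpos : 0 < b (m + 1) := lt_of_lt_of_le (by positivity) hb1
    have hxm : 0 ≤ x (m + 1) := by
      have : 0 ≤ p * x (m + 1) := le_trans (by positivity) hx1
      exact nonneg_of_mul_nonneg_right this hp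
    refine ⟨hxm, ?_⟩
    refine le_of_mul_le_mul_left ?_ (mul_pos hbpos hqp)
    have h1 := mul_le_mul_of_nonneg_left hx1 (mul_nonneg hc01 hp.le)
    have h2 : p * q * (p - q) ≤ q * b (m + 1) - p * c (m + 1) := by
      nlinarith [mul_le_mul_of_nonneg_left hb1 hq, mul_le_mul_of_nonneg_left hc1 hp.le]
    have h3 : s ^ 2 ≤ (p - q) ^ 2 := pow_le_pow_left₀ hs hpq 2
    have h4 : p * q * s ^ 2 ≤ (p - q) * (q * b (m + 1) - p * c (m + 1)) := by
      calc p * q * s ^ 2 ≤ p * q * (p - q) ^ 2 := by gcongr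
        _ = (p - q) * (p * q * (p - q)) := by ring
        _ ≤ _ := mul_le_mul_of_nonneg_left h2 (by linarith)
    have h5 := mul_le_mul_of_nonneg_right h4 hxm
    have h6 := h m hm
    linear_combination h5 + h1 - q * p * h6

/-- The energy of the solution between the positions `m` and `m + 1`. -/
noncomputable def energy (c a b : ℕ → ℝ) (θ : ℝ) (m : ℕ) : ℝ :=
  kappa c a b m * (stdSeq c a b θ m ^ 2 + stdSeq c a b θ (m + 1) ^ 2)

/-- The constant by which the energy grows at most from one position to the next. -/
noncomputable def stepConst (κ : ℝ) : ℝ := κ * (2 * κ ^ 2 + 1)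

namespace MonotoneRows

variable {κ : ℝ} {D : ℕ} {c a b : ℕ → ℝ} (R : MonotoneRows κ D c a b)
include R

/-- By monotonicity all rows up to `M` are at least as favourable as row `M`: their `b` is larger
and their `c` smaller. Hence one critical ratio works throughout the initial zone. -/
theorem forward_ratio {s θ : ℝ} (hs : 0 ≤ s) (hθ : θ = κ - s ^ 2) {M : ℕ} (hM1 : 1 ≤ M)
    (hMD : M < D) (hM : s ≤ √(b M) - √(c M)) {m : ℕ} (hm : m ≤ M) :
    0 ≤ stdSeq c a b θ m ∧
      √(c M) * stdSeq c a b θ m ≤ √(b M) * stdSeq c a b θ (m + 1) := by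
  have hb := R.one_le_b M hMD
  have hc := R.one_le_c M hM1 hMD.le
  refine ratio_le_of_recurrence hs (Real.sqrt_pos.2 (by linarith)) (Real.sqrt_nonneg _) hM (b := b)
    (c := c) (M := M) ?_ ?_ ?_ ?_ ?_ ?_ ?_ m hm
  · intro m hm
    rw [Real.sq_sqrt (by linarith)]
    exact R.b_anti m M hm hMD.le
  · intro m hm
    rw [Real.sq_sqrt (by linarith)]
    exact R.c_mono m M hm hMD.le
  · exact fun m hm => R.c_nonneg (by omega)
  · exact fun _ => Real.sqrt_pos.2 (by linarith)
  · rw [stdSeq_zero]; exact zero_le_one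
  · rw [R.b_zero, R.stdSeq_one, stdSeq_zero, hθ, mul_one]
  · intro m hm
    rw [R.stdSeq_succ θ (by omega), hθ]
    ring

theorem forward_pos {s θ : ℝ} (hs : 0 ≤ s) (hθ : θ = κ - s ^ 2) {M : ℕ} (hM1 : 1 ≤ M)
    (hMD : M < D) (hM : s ≤ √(b M) - √(c M)) {m : ℕ} (hm : m ≤ M + 1) :
    0 < stdSeq c a b θ m := by
  have hb := R.one_le_b M hMD
  have hc := R.one_le_c M hM1 hMD.le
  have hp : 0 < √(b M) := Real.sqrt_pos.2 (by linarith)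
  have hq : 0 < √(c M) := Real.sqrt_pos.2 (by linarith)
  induction m with
  | zero => rw [stdSeq_zero]; exact one_pos
  | succ m ih =>
    have h1 := ih (by omega)
    have h2 := (R.forward_ratio hs hθ hM1 hMD hM (m := m) (by omega)).2
    exact pos_of_mul_pos_right (lt_of_lt_of_le (mul_pos hq h1) h2) hp.le

theorem forward_sq {s θ : ℝ} (hs : 0 ≤ s) (hθ : θ = κ - s ^ 2) {M : ℕ} (hM1 : 1 ≤ M)
    (hMD : M < D) (hM : s ≤ √(b M) - √(c M)) {m : ℕ} (hm : m ≤ M) :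
    c M * stdSeq c a b θ m ^ 2 ≤ b M * stdSeq c a b θ (m + 1) ^ 2 := by
  obtain ⟨h1, h2⟩ := R.forward_ratio hs hθ hM1 hMD hM hm
  have h3 := pow_le_pow_left₀ (mul_nonneg (Real.sqrt_nonneg _) h1) h2 2
  rwa [mul_pow, mul_pow, Real.sq_sqrt (R.c_nonneg hMD.le), Real.sq_sqrt (R.b_nonneg hMD.le)] at h3

theorem sqrt_sub_antitone {m M : ℕ} (hm : m ≤ M) (hMD : M ≤ D) :
    √(b M) - √(c M) ≤ √(b m) - √(c m) := by
  have h1 := Real.sqrt_le_sqrt (R.b_anti m M hm hMD)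
  have h2 := Real.sqrt_le_sqrt (R.c_mono m M hm hMD)
  linarith

/-- With the weight `κ_m c_m = κ_{m-1} b_{m-1}` the one-step inequality telescopes exactly, so no
constant accumulates along the zone. -/
theorem forward_weight_mono {s θ : ℝ} (hs : 0 ≤ s) (hθ : θ = κ - s ^ 2) {M : ℕ}
    (hMD : M < D) (hM : s ≤ √(b M) - √(c M)) {m : ℕ} (hm1 : 1 ≤ m) (hm : m ≤ M + 1) :
    kappa c a b m * c m * stdSeq c a b θ m ^ 2 ≤
      kappa c a b (M + 1) * c (M + 1) * stdSeq c a b θ (M + 1) ^ 2 := by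
  induction M with
  | zero =>
    obtain rfl : m = 1 := by omega
    rfl
  | succ M ih =>
    rcases Nat.lt_or_ge m (M + 2) with h | h
    · refine (ih (by omega) (hM.trans (R.sqrt_sub_antitone (by omega) hMD.le)) (by omega)).trans ?_
      have h1 := R.forward_sq hs hθ (by omega) hMD hM le_rfl
      have h2 := R.kappa_succ hMD
      have h3 := R.kappa_pos hMD.le
      rw [h2]
      nlinarith [mul_le_mul_of_nonneg_left h1 h3.le]
    · obtain rfl : m = M + 2 := by omega
      rfl

theorem kappa_le_mul_succ {m : ℕ} (hm : m < D) : kappa c a b m ≤ κ * kappa c a b (m + 1) := by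
  have h1 := R.kappa_succ hm
  have h2 := R.one_le_b m hm
  have h3 := R.c_le (m := m + 1) hm
  have h4 := R.kappa_pos hm.le
  have h5 := R.kappa_pos (m := m + 1) hm
  nlinarith

theorem kappa_succ_le_mul {m : ℕ} (hm : m < D) : kappa c a b (m + 1) ≤ κ * kappa c a b m := by
  have h1 := R.kappa_succ hm
  have h2 := R.one_le_c (m + 1) (by omega) hm
  have h3 := R.b_le hm.le
  have h4 := R.kappa_pos hm.le
  have h5 := R.kappa_pos (m := m + 1) hm
  nlinarith

theorem forward_le {s θ : ℝ} (hs : 0 ≤ s) (hθ : θ = κ - s ^ 2) {M : ℕ} (hM1 : 1 ≤ M)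
    (hMD : M < D) (hM : s ≤ √(b M) - √(c M)) {m : ℕ} (hm : m ≤ M + 1) :
    kappa c a b m * stdSeq c a b θ m ^ 2 ≤
      κ * (kappa c a b (M + 1) * stdSeq c a b θ (M + 1) ^ 2) := by
  have hlast : kappa c a b (M + 1) * c (M + 1) * stdSeq c a b θ (M + 1) ^ 2 ≤
      κ * (kappa c a b (M + 1) * stdSeq c a b θ (M + 1) ^ 2) := by
    have h1 := R.c_le (m := M + 1) hMD
    have h2 : 0 ≤ kappa c a b (M + 1) * stdSeq c a b θ (M + 1) ^ 2 :=
      mul_nonneg (R.kappa_pos hMD).le (sq_nonneg _)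
    nlinarith
  -- Position 0 is separate because `c 0 = 0` kills the weight. There `1 ≤ c M ≤ b M · x₁² ≤ κ x₁²`
  -- is used instead.
  rcases Nat.eq_zero_or_pos m with rfl | hpos
  · refine le_trans ?_ ((R.forward_weight_mono hs hθ hMD hM le_rfl (by omega)).trans hlast)
    have h1 := R.forward_sq hs hθ hM1 hMD hM (Nat.zero_le _)
    have h2 := R.one_le_c M hM1 hMD.le
    have h3 := R.b_le hMD.le
    have h4 := R.kappa_succ (m := 0) (by omega)
    rw [zero_add] at h4 h1
    rw [stdSeq_zero] at h1 ⊢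
    rw [h4, R.b_zero]
    have h5 : kappa c a b 0 = 1 := by simp [kappa, vPoly]
    rw [h5]
    nlinarith [sq_nonneg (stdSeq c a b θ 1)]
  · refine le_trans ?_ ((R.forward_weight_mono hs hθ hMD hM hpos hm).trans hlast)
    have h1 := R.one_le_c m hpos (by omega)
    have h2 : 0 ≤ kappa c a b m * stdSeq c a b θ m ^ 2 :=
      mul_nonneg (R.kappa_pos (by omega)).le (sq_nonneg _)
    nlinarith

/-- The solutions for two values of the parameter separate exponentially. -/
theorem forward_compare {s s' θ θ' : ℝ} (hs : 0 ≤ s) (hs' : 0 ≤ s') (hθ : θ = κ - s ^ 2)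
    (hθ' : θ' = κ - s' ^ 2) (hle : θ ≤ θ') {M : ℕ} (hM1 : 1 ≤ M) (hMD : M < D)
    (hM : s ≤ √(b M) - √(c M)) (hM' : s' ≤ √(b M) - √(c M)) :
    (1 + (θ' - θ) / κ) ^ (M + 1) * stdSeq c a b θ (M + 1) ≤ stdSeq c a b θ' (M + 1) := by
  have hκ := R.one_le_κ
  set d := (θ' - θ) / κ with hd
  have hd0 : 0 ≤ d := div_nonneg (by linarith) (by linarith)
  have hκd : κ * d = θ' - θ := by rw [hd]; field_simp
  set x := stdSeq c a b θ with hx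
  set x' := stdSeq c a b θ' with hx'
  have hp : ∀ m ≤ M + 1, 0 < x m := fun m hm => R.forward_pos hs hθ hM1 hMD hM hm
  have hp' : ∀ m ≤ M + 1, 0 < x' m := fun m hm => R.forward_pos hs' hθ' hM1 hMD hM' hm
  have hx0 : x 0 = 1 := stdSeq_zero _ _ _ _
  have hx0' : x' 0 = 1 := stdSeq_zero _ _ _ _
  -- The ratio of consecutive terms for `θ'` exceeds that for `θ` by the factor `1 + d` at every
  -- step.
  have key : ∀ m ≤ M, x (m + 1) ≤ x m ∧ (1 + d) * (x' m * x (m + 1)) ≤ x' (m + 1) * x m := by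
    intro m
    induction m with
    | zero =>
      intro _
      have h1 : κ * x 1 = θ := R.stdSeq_one θ
      have h2 : κ * x' 1 = θ' := R.stdSeq_one θ'
      rw [zero_add, hx0, hx0']
      have h3 : x 1 ≤ 1 := by
        have : κ * x 1 ≤ κ * 1 := by rw [h1, hθ]; nlinarith [sq_nonneg s]
        exact le_of_mul_le_mul_left this (by linarith)
      refine ⟨h3, le_of_mul_le_mul_left (a := κ) ?_ (by linarith)⟩
      nlinarith
    | succ m ih =>
      intro hm
      obtain ⟨ih1, ih2⟩ := ih (by omega)
      have e := R.stdSeq_succ θ (m := m) (by omega)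
      have e' := R.stdSeq_succ θ' (m := m) (by omega)
      rw [← hx] at e
      rw [← hx'] at e'
      have hb := R.one_le_b (m + 1) (by omega)
      have hbκ := R.b_le (m := m + 1) (by omega)
      have hc := R.one_le_c (m + 1) (by omega) (by omega)
      have p0 := hp m (by omega)
      have p1 := hp (m + 1) (by omega)
      have p2 := hp (m + 2) (by omega)
      have p0' := hp' m (by omega)
      have p1' := hp' (m + 1) (by omega)
      have h1 : x (m + 2) ≤ x (m + 1) := by
        refine le_of_mul_le_mul_left (a := b (m + 1)) ?_ (by linarith)
        rw [e, hθ]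
        nlinarith [mul_nonneg (sq_nonneg s) p1.le, mul_le_mul_of_nonneg_left ih1 (by linarith : 0 ≤ c (m + 1))]
      refine ⟨h1, le_of_mul_le_mul_left (a := b (m + 1)) ?_ (by linarith)⟩
      have h2 : x' m * x (m + 1) ≤ x' (m + 1) * x m := by
        nlinarith [mul_nonneg hd0 (mul_pos p0' p1).le]
      have h3 := mul_le_mul_of_nonneg_left h2 (by linarith : 0 ≤ c (m + 1))
      -- The surplus `θ' - θ = κ d` in the recurrence pays for the extra factor, since `b ≤ κ` and
      -- the solution for `θ` does not increase.
      have h4 : b (m + 1) * d * x (m + 2) ≤ κ * d * x (m + 1) := by gcongr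
      have h5 := mul_le_mul_of_nonneg_left h4 p1'.le
      rw [hκd] at h5
      linear_combination h3 + h5 + x' (m + 1) * e - x (m + 1) * e'
  have hpow : ∀ m ≤ M + 1, (1 + d) ^ m * x m ≤ x' m := by
    intro m
    induction m with
    | zero => intro _; rw [hx0, hx0']; simp
    | succ m ih =>
      intro hm
      have h1 := ih (by omega)
      have h2 := (key m (by omega)).2
      have p0 := hp m (by omega)
      have p1 := hp (m + 1) hm
      refine le_of_mul_le_mul_right ?_ p0
      refine le_trans ?_ h2
      have h3 := mul_le_mul_of_nonneg_right h1 (mul_nonneg (by linarith : 0 ≤ 1 + d) p1.le)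
      rw [pow_succ]
      linarith
  exact hpow (M + 1) le_rfl

/-- Reading the recurrence from `D` downwards exchanges `b` and `c`, and the end condition plays the
part of the first row. The sign `σ = ±1` in the proof makes the starting value `x_D` nonnegative. -/
theorem backward_sq {s θ : ℝ} (hs : 0 ≤ s) (hθ : θ = κ - s ^ 2)
    (hend : c D * stdSeq c a b θ (D - 1) = (c D - (κ - θ)) * stdSeq c a b θ D)
    {m : ℕ} (hm1 : 1 ≤ m) (hmD : m < D) (hm : s ≤ √(c m) - √(b m)) :
    b m * stdSeq c a b θ m ^ 2 ≤ c m * stdSeq c a b θ (m - 1) ^ 2 := by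
  have hb := R.one_le_b m hmD
  have hc := R.one_le_c m hm1 hmD.le
  have key : ∀ σ : ℝ, 0 ≤ σ * stdSeq c a b θ D → 0 ≤ σ * stdSeq c a b θ m ∧
      √(b m) * (σ * stdSeq c a b θ m) ≤ √(c m) * (σ * stdSeq c a b θ (m - 1)) := by
    intro σ hσ
    have h := ratio_le_of_recurrence (b := fun j => c (D - j)) (c := fun j => b (D - j))
      (x := fun j => σ * stdSeq c a b θ (D - j)) (M := D - m) hs
      (Real.sqrt_pos.2 (by linarith : 0 < c m)) (Real.sqrt_nonneg (b m)) hm ?_ ?_ ?_ ?_ ?_ ?_ ?_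
      (D - m) le_rfl
    · rwa [show D - (D - m) = m by omega, show D - (D - m + 1) = m - 1 by omega] at h
    · intro j hj
      rw [Real.sq_sqrt (by linarith)]
      exact R.c_mono _ _ (by omega) (by omega)
    · intro j hj
      rw [Real.sq_sqrt (by linarith)]
      exact R.b_anti _ _ (by omega) (by omega)
    · exact fun j hj => R.b_nonneg (by omega)
    · exact fun _ => Real.sqrt_pos.2 (by linarith)
    · simpa using hσ
    · simp only [Nat.sub_zero]
      rw [show s ^ 2 = κ - θ by linarith]
      linear_combination σ * hend
    · intro j hj
      obtain ⟨i, hi⟩ : ∃ i, D = i + j + 2 := ⟨D - j - 2, by omega⟩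
      have e := R.stdSeq_succ θ (m := i) (by omega)
      rw [show D - (j + 1) = i + 1 by omega, show D - (j + 2) = i by omega,
        show D - j = i + 2 by omega, show s ^ 2 = κ - θ by linarith]
      linear_combination σ * e
  have fin : ∀ σ : ℝ, σ ^ 2 = 1 → 0 ≤ σ * stdSeq c a b θ D →
      b m * stdSeq c a b θ m ^ 2 ≤ c m * stdSeq c a b θ (m - 1) ^ 2 := by
    intro σ h1 hσ
    obtain ⟨h2, h3⟩ := key σ hσ
    have h4 := pow_le_pow_left₀ (mul_nonneg (Real.sqrt_nonneg _) h2) h3 2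
    rwa [mul_pow, mul_pow, mul_pow, mul_pow, Real.sq_sqrt (by linarith), Real.sq_sqrt (by linarith),
      h1, one_mul, one_mul] at h4
  rcases le_total 0 (stdSeq c a b θ D) with h | h
  · exact fin 1 (by norm_num) (by simpa using h)
  · exact fin (-1) (by norm_num) (by simpa using h)

/-- Mirror image of `forward_weight_mono`: with the weight `κ_m b_m` the decay telescopes without
constants. -/
theorem backward_weight_le {s θ : ℝ} (hs : 0 ≤ s) (hθ : θ = κ - s ^ 2)
    (hend : c D * stdSeq c a b θ (D - 1) = (c D - (κ - θ)) * stdSeq c a b θ D) {N : ℕ}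
    (hN : 1 ≤ N) (hfin : ∀ m, N ≤ m → m < D → s ≤ √(c m) - √(b m)) {m : ℕ} (hNm : N ≤ m + 1)
    (hm : m < D) :
    kappa c a b m * b m * stdSeq c a b θ m ^ 2 ≤
      kappa c a b (N - 1) * b (N - 1) * stdSeq c a b θ (N - 1) ^ 2 := by
  induction m with
  | zero =>
    obtain rfl : N = 1 := by omega
    rfl
  | succ m ih =>
    rcases Nat.lt_or_ge (m + 1) N with h | h
    · obtain rfl : N = m + 2 := by omega
      rfl
    · refine le_trans ?_ (ih h (by omega))
      have h1 := R.backward_sq hs hθ hend (by omega) hm (hfin _ h hm)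
      rw [Nat.add_sub_cancel] at h1
      have h2 := R.kappa_succ (m := m) (by omega)
      have h3 := R.kappa_pos hm.le
      rw [← h2]
      nlinarith [mul_le_mul_of_nonneg_left h1 h3.le]

theorem energy_nonneg (θ : ℝ) {m : ℕ} (hm : m ≤ D) : 0 ≤ energy c a b θ m :=
  mul_nonneg (R.kappa_pos hm).le (by positivity)

/-- A crude bound that needs only `0 ≤ θ ≤ κ`, wherever `θ` lies relative to the row: `b ≥ 1` lets
one solve for the next term, and the coefficients are at most `κ` in absolute value. -/
theorem energy_step {θ : ℝ} (h0 : 0 ≤ θ) (h1 : θ ≤ κ) {m : ℕ} (hm : m + 1 < D) :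
    energy c a b θ (m + 1) ≤ stepConst κ * energy c a b θ m := by
  have e := R.stdSeq_succ θ hm
  set x := stdSeq c a b θ with hx
  have hκ := R.one_le_κ
  have hb := R.one_le_b (m + 1) hm
  have hc := R.c_nonneg (m := m + 1) (by omega)
  have hcκ := R.c_le (m := m + 1) (by omega)
  have hs := R.sum_eq (m + 1) (by omega)
  have ha := R.a_nonneg (m + 1) (by omega)
  set f := b (m + 1) + c (m + 1) - (κ - θ) with hf
  have hfsq : f ^ 2 ≤ κ ^ 2 := by
    refine sq_le_sq' ?_ ?_ <;> linarith
  have hcsq : c (m + 1) ^ 2 ≤ κ ^ 2 := pow_le_pow_left₀ hc hcκ 2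
  have h2 : x (m + 2) ^ 2 ≤ 2 * κ ^ 2 * (x m ^ 2 + x (m + 1) ^ 2) := by
    have h3 : x (m + 2) ^ 2 ≤ (b (m + 1) * x (m + 2)) ^ 2 := by
      rw [mul_pow]
      have : 1 ≤ b (m + 1) ^ 2 := one_le_pow₀ hb
      nlinarith [sq_nonneg (x (m + 2))]
    rw [e] at h3
    have h4 : (f * x (m + 1) - c (m + 1) * x m) ^ 2 ≤
        2 * (f ^ 2 * x (m + 1) ^ 2 + c (m + 1) ^ 2 * x m ^ 2) := by
      nlinarith [sq_nonneg (f * x (m + 1) + c (m + 1) * x m)]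
    have h5 := mul_le_mul_of_nonneg_right hfsq (sq_nonneg (x (m + 1)))
    have h6 := mul_le_mul_of_nonneg_right hcsq (sq_nonneg (x m))
    linarith
  have h7 := R.kappa_succ_le_mul (m := m) (by omega)
  have h8 := R.kappa_pos (m := m) (by omega)
  unfold energy stepConst
  calc kappa c a b (m + 1) * (x (m + 1) ^ 2 + x (m + 1 + 1) ^ 2)
      ≤ (κ * kappa c a b m) * ((2 * κ ^ 2 + 1) * (x m ^ 2 + x (m + 1) ^ 2)) := by
        refine mul_le_mul h7 ?_ (by positivity) (by positivity)
        nlinarith [sq_nonneg (x m)]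
    _ = _ := by ring

/-- Inside a block the quantity `κ_m (β x_{m+1}² - e x_m x_{m+1} + γ x_m²)` is conserved. The
discriminant condition makes the form comparable to `x_m² + x_{m+1}²`, between `f / (8κ)` and `2κ`,
so the loss does not depend on the length of the block. -/
theorem energy_block {θ : ℝ} {β γ f : ℝ} (hf : 0 < f)
    (hβγ : f ≤ 4 * (β * γ) - (β + γ - (κ - θ)) ^ 2) (hγ : 0 ≤ γ) {S n : ℕ}
    (hn : S + n ≤ D) (hrow : ∀ m, S ≤ m → m < S + n → b m = β ∧ c m = γ) {j : ℕ}
    (hj : j < n) :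
    energy c a b θ (S + j) ≤ 16 * κ ^ 2 / f * energy c a b θ S := by
  have hκ := R.one_le_κ
  set x := stdSeq c a b θ with hx
  set e := β + γ - (κ - θ) with he
  have hβκ : β ≤ κ := by rw [← (hrow S le_rfl (by omega)).1]; exact R.b_le (by omega)
  have hγκ : γ ≤ κ := by rw [← (hrow S le_rfl (by omega)).2]; exact R.c_le (by omega)
  have hinv : ∀ j < n, kappa c a b (S + j) *
      (β * x (S + j + 1) ^ 2 - e * x (S + j) * x (S + j + 1) + γ * x (S + j) ^ 2) =
      kappa c a b S * (β * x (S + 1) ^ 2 - e * x S * x (S + 1) + γ * x S ^ 2) := by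
    intro j
    induction j with
    | zero => intro _; rfl
    | succ j ih =>
      intro hj
      rw [← ih (by omega)]
      have hr := hrow (S + j) (by omega) (by omega)
      have hr' := hrow (S + j + 1) (by omega) (by omega)
      have h1 := R.stdSeq_succ θ (m := S + j) (by omega)
      have h2 := R.kappa_succ (m := S + j) (by omega)
      rw [hr'.2, hr.1] at h2
      rw [hr'.1, hr'.2, ← he, ← hx] at h1
      rw [← add_assoc]
      linear_combination
        (kappa c a b (S + j + 1) * x (S + j + 2) - kappa c a b (S + j) * x (S + j)) * h1 +
          (x (S + j + 1) ^ 2 - x (S + j) * x (S + j + 2)) * h2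
  have hQ := hinv j hj
  have hk := R.kappa_pos (m := S + j) (by omega)
  have hk0 := R.kappa_pos (m := S) (by omega)
  have hlow : ∀ u v : ℝ, f * (u ^ 2 + v ^ 2) ≤ 8 * κ * (β * v ^ 2 - e * u * v + γ * u ^ 2) := by
    intro u v
    have h1 : f * v ^ 2 ≤ 4 * γ * (β * v ^ 2 - e * u * v + γ * u ^ 2) := by
      nlinarith [sq_nonneg (2 * γ * u - e * v), mul_le_mul_of_nonneg_right hβγ (sq_nonneg v)]
    have h2 : f * u ^ 2 ≤ 4 * β * (β * v ^ 2 - e * u * v + γ * u ^ 2) := by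
      nlinarith [sq_nonneg (2 * β * v - e * u), mul_le_mul_of_nonneg_right hβγ (sq_nonneg u)]
    have h3 : 0 < γ := by
      rcases hγ.eq_or_lt with h | h
      · rw [← h] at hβγ; nlinarith [sq_nonneg e]
      · exact h
    have h4 : 0 ≤ β * v ^ 2 - e * u * v + γ * u ^ 2 := by
      have : 0 ≤ 4 * γ * (β * v ^ 2 - e * u * v + γ * u ^ 2) := le_trans (by positivity) h1
      exact nonneg_of_mul_nonneg_right this (by positivity)
    have h5 := mul_le_mul_of_nonneg_right hγκ h4
    have h6 := mul_le_mul_of_nonneg_right hβκ h4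
    linarith
  have hup : ∀ u v : ℝ, β * v ^ 2 - e * u * v + γ * u ^ 2 ≤ 2 * κ * (u ^ 2 + v ^ 2) := by
    intro u v
    have h1 : e ^ 2 ≤ (2 * κ) ^ 2 := by
      have := mul_le_mul hβκ hγκ hγ (by linarith)
      nlinarith
    obtain ⟨h2, h3⟩ := abs_le_of_sq_le_sq' h1 (by linarith)
    have h4 := mul_le_mul_of_nonneg_right hβκ (sq_nonneg v)
    have h5 := mul_le_mul_of_nonneg_right hγκ (sq_nonneg u)
    nlinarith [mul_nonneg (by linarith : 0 ≤ 2 * κ - e) (sq_nonneg (u - v)),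
      mul_nonneg (by linarith : 0 ≤ 2 * κ + e) (sq_nonneg (u + v))]
  unfold energy
  rw [← hx]
  have h1 := mul_le_mul_of_nonneg_left (hlow (x (S + j)) (x (S + j + 1))) hk.le
  have h2 := mul_le_mul_of_nonneg_left (hup (x S) (x (S + 1))) hk0.le
  rw [div_mul_eq_mul_div, le_div_iff₀ hf]
  nlinarith

/-- Upper bound of the squared norm of an eigenvector: between the initial zone `{1, …, M}` and the
final zone `{N, …, D}`, where it grows respectively decays, it changes only by the factors that
`w` counts. -/
theorem sqNorm_le {s θ : ℝ} (hs : 0 ≤ s) (hθ : θ = κ - s ^ 2) (hθ0 : 0 ≤ θ)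
    (hend : c D * stdSeq c a b θ (D - 1) = (c D - (κ - θ)) * stdSeq c a b θ D) {M N : ℕ}
    (hM1 : 1 ≤ M) (hMN : M < N) (hND : N ≤ D) (hM : s ≤ √(b M) - √(c M))
    (hfin : ∀ m, N ≤ m → m < D → s ≤ √(c m) - √(b m)) {K : ℝ} (hK : stepConst κ ≤ K) {w : ℕ → ℕ}
    (hmid : ∀ m, M < m → m < N → 1 ≤ w m ∨ ∃ S, M < S ∧ S ≤ m ∧ 2 ≤ w S ∧
      energy c a b θ m ≤ K * energy c a b θ S) :
    sqNorm D c a b θ ≤ (D + 1) * (K ^ (∑ m ∈ range D, w m + 3) *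
      (kappa c a b (M + 1) * stdSeq c a b θ (M + 1) ^ 2)) := by
  have hκ := R.one_le_κ
  have hθκ : θ ≤ κ := by rw [hθ]; linarith [sq_nonneg s]
  set x := stdSeq c a b θ with hx
  set Y := kappa c a b (M + 1) * x (M + 1) ^ 2 with hY
  have hY0 : 0 ≤ Y := mul_nonneg (R.kappa_pos (by omega)).le (sq_nonneg _)
  have hκ2 : κ ≤ κ ^ 2 := by nlinarith
  have hK1 : 2 * κ ^ 2 ≤ K := by
    refine le_trans ?_ hK
    unfold stepConst
    nlinarith [mul_nonneg (by linarith : 0 ≤ κ - 1) (sq_nonneg κ)]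
  have hK2 : κ * (1 + κ) ≤ K := by linarith
  have hKone : 1 ≤ K := by linarith [sq_nonneg κ]
  have hEM : energy c a b θ M ≤ 2 * κ * Y := by
    have h1 := R.forward_le hs hθ hM1 (by omega) hM (m := M) (by omega)
    have h2 := R.kappa_le_mul_succ (m := M) (by omega)
    have h3 := mul_le_mul_of_nonneg_right h2 (sq_nonneg (x (M + 1)))
    rw [← hx] at h1
    unfold energy
    rw [← hx, mul_add]
    linarith
  set W := ∑ m ∈ range D, w m with hW
  -- The exponent is the accumulated weight: a row of weight at least 1 pays for one crude step, a
  -- block start of weight at least 2 pays for a crude step onto it and for the comparison with any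
  -- later row of the block.
  have hEmid : ∀ m, M ≤ m → m < N →
      energy c a b θ m ≤ K ^ (∑ r ∈ range (m + 1), w r) * energy c a b θ M := by
    have hE0 := R.energy_nonneg θ (m := M) (by omega)
    have hstep : ∀ m, M ≤ m → m + 1 < N →
        energy c a b θ (m + 1) ≤ K * energy c a b θ m := fun m _ h2 =>
      (R.energy_step hθ0 hθκ (by omega)).trans
        (mul_le_mul_of_nonneg_right hK (R.energy_nonneg θ (by omega)))
    intro m
    induction m using Nat.strong_induction_on with
    | _ m ih =>
      intro h1 h2
      rcases h1.eq_or_lt with rfl | h1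
      · exact le_mul_of_one_le_left hE0 (one_le_pow₀ hKone)
      have hprev : ∀ S, M < S → S < N → (∀ r, r < S → r < m) →
          energy c a b θ S ≤ K ^ (∑ r ∈ range S, w r + 1) * energy c a b θ M := by
        intro S hS hSN hSm
        obtain ⟨r, rfl⟩ : ∃ r, S = r + 1 := ⟨S - 1, by omega⟩
        have h3 := ih r (hSm r (by omega)) (by omega) (by omega)
        refine (hstep r (by omega) hSN).trans ?_
        rw [pow_succ]
        nlinarith [mul_le_mul_of_nonneg_left h3 (by linarith : 0 ≤ K)]
      rcases hmid m h1 h2 with h | ⟨S, hS1, hS2, hS3, hS4⟩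
      · refine (hprev m h1 h2 fun r hr => hr).trans ?_
        refine mul_le_mul_of_nonneg_right (pow_le_pow_right₀ hKone ?_) hE0
        rw [sum_range_succ]
        omega
      · have h3 := hprev S hS1 (by omega) fun r hr => by omega
        refine hS4.trans ((mul_le_mul_of_nonneg_left h3 (by linarith)).trans ?_)
        rw [← mul_assoc, ← pow_succ']
        refine mul_le_mul_of_nonneg_right (pow_le_pow_right₀ hKone ?_) hE0
        have h4 : ∑ r ∈ range (S + 1), w r ≤ ∑ r ∈ range (m + 1), w r :=
          sum_le_sum_of_subset (range_subset_range.2 (by omega))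
        rw [sum_range_succ] at h4
        omega
  have hEmid' : ∀ m, M ≤ m → m < N → energy c a b θ m ≤ K ^ W * (2 * κ * Y) := by
    intro m h1 h2
    refine (hEmid m h1 h2).trans (mul_le_mul (pow_le_pow_right₀ hKone ?_) hEM
      (R.energy_nonneg θ (by omega)) (by positivity))
    exact sum_le_sum_of_subset (range_subset_range.2 (by omega))
  have hYE : ∀ m ≤ D, kappa c a b m * x m ^ 2 ≤ energy c a b θ m := by
    intro m hm
    have := R.kappa_pos hm
    unfold energy
    rw [← hx]
    nlinarith [mul_nonneg this.le (sq_nonneg (x (m + 1)))]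
  have hKW : 1 ≤ K ^ W := one_le_pow₀ hKone
  set Z := K ^ W * (2 * κ ^ 2 * Y) with hZ
  have hZ0 : 0 ≤ Z := by positivity
  have hsmall : ∀ m < D, kappa c a b m * x m ^ 2 ≤ Z := by
    intro m hm
    have hle1 : κ * Y ≤ Z := by
      have h1 : κ * Y ≤ 2 * κ ^ 2 * Y := mul_le_mul_of_nonneg_right (by linarith) hY0
      exact h1.trans (le_mul_of_one_le_left (by positivity) hKW)
    have hle2 : K ^ W * (2 * κ * Y) ≤ Z := by
      refine mul_le_mul_of_nonneg_left (mul_le_mul_of_nonneg_right ?_ hY0) (by positivity)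
      linarith
    rcases Nat.lt_or_ge M m with h | h
    · rcases Nat.lt_or_ge m N with h' | h'
      · exact ((hYE m hm.le).trans (hEmid' m h.le h')).trans hle2
      · have h1 := R.backward_weight_le hs hθ hend (N := N) (by omega) hfin (m := m) (by omega) hm
        have h2 := (hYE (N - 1) (by omega)).trans (hEmid' (N - 1) (by omega) (by omega))
        have h3 := R.one_le_b m hm
        have h4 := R.b_le (m := N - 1) (by omega)
        have h5 : 0 ≤ kappa c a b m * x m ^ 2 := mul_nonneg (R.kappa_pos hm.le).le (sq_nonneg _)
        have h6 : 0 ≤ kappa c a b (N - 1) * x (N - 1) ^ 2 :=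
          mul_nonneg (R.kappa_pos (by omega)).le (sq_nonneg _)
        calc kappa c a b m * x m ^ 2 ≤ kappa c a b m * b m * x m ^ 2 := by nlinarith
          _ ≤ kappa c a b (N - 1) * b (N - 1) * x (N - 1) ^ 2 := h1
          _ ≤ κ * (kappa c a b (N - 1) * x (N - 1) ^ 2) := by nlinarith
          _ ≤ κ * (K ^ W * (2 * κ * Y)) := by gcongr
          _ = Z := by rw [hZ]; ring
    · exact (R.forward_le hs hθ hM1 (by omega) hM (m := m) (by omega)).trans hle1
  -- The 3 in the exponent: one `K` absorbs `2κ²` from the two ends of the middle zone, one absorbs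
  -- `κ (1 + κ)`, and one is a further energy step for the last entry.
  have hZK : κ * (1 + κ) * (K * Z) ≤ K ^ (W + 3) * Y := by
    have h1 : κ * (1 + κ) * (2 * κ ^ 2) ≤ K * K := mul_le_mul hK2 hK1 (by positivity) (by linarith)
    calc κ * (1 + κ) * (K * Z) = κ * (1 + κ) * (2 * κ ^ 2) * (K * K ^ W * Y) := by rw [hZ]; ring
      _ ≤ K * K * (K * K ^ W * Y) := mul_le_mul_of_nonneg_right h1 (by positivity)
      _ = K ^ (W + 3) * Y := by ring
  have hall : ∀ m ∈ range (D + 1), kappa c a b m * x m ^ 2 ≤ K ^ (W + 3) * Y := by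
    intro m hm
    refine le_trans ?_ hZK
    rcases Nat.lt_or_ge m D with h | h
    · refine (hsmall m h).trans ?_
      have h1 : Z ≤ K * Z := le_mul_of_one_le_left hZ0 hKone
      exact h1.trans (le_mul_of_one_le_left (by positivity) (by nlinarith))
    -- Since `b D = 0`, the backward weight says nothing about position `D`. That entry is reached
    -- by an energy step from `D - 2`; `D ≥ 2` follows from `1 ≤ M < N ≤ D`.
    · obtain ⟨n, rfl⟩ : ∃ n, D = n + 2 := ⟨D - 2, by omega⟩
      obtain rfl : m = n + 2 := by rw [mem_range] at hm; omega
      have h1 := R.kappa_succ_le_mul (m := n + 1) (by omega)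
      have h2 := R.energy_step hθ0 hθκ (m := n) (by omega)
      have h3 := R.kappa_le_mul_succ (m := n) (by omega)
      have h4 := hsmall n (by omega)
      have h5 := hsmall (n + 1) (by omega)
      have h6 : energy c a b θ n ≤ (1 + κ) * Z := by
        unfold energy
        rw [← hx]
        have := mul_le_mul_of_nonneg_right h3 (sq_nonneg (x (n + 1)))
        nlinarith
      have h7 : kappa c a b (n + 1) * x (n + 2) ^ 2 ≤ energy c a b θ (n + 1) := by
        unfold energy
        rw [← hx]
        nlinarith [mul_nonneg (R.kappa_pos (m := n + 1) (by omega)).le (sq_nonneg (x (n + 1)))]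
      have h8 := mul_le_mul hK h6 (R.energy_nonneg θ (by omega)) (by linarith)
      calc kappa c a b (n + 2) * x (n + 2) ^ 2 ≤ κ * kappa c a b (n + 1) * x (n + 2) ^ 2 :=
            mul_le_mul_of_nonneg_right h1 (sq_nonneg _)
        _ = κ * (kappa c a b (n + 1) * x (n + 2) ^ 2) := by ring
        _ ≤ κ * (K * ((1 + κ) * Z)) := by
            refine mul_le_mul_of_nonneg_left ?_ (by linarith)
            exact h7.trans (h2.trans h8)
        _ = κ * (1 + κ) * (K * Z) := by ring
  calc sqNorm D c a b θ ≤ ∑ m ∈ range (D + 1), K ^ (W + 3) * Y := sum_le_sum hall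
    _ = _ := by rw [sum_const, card_range, nsmul_eq_mul]; push_cast; ring

theorem le_sqNorm (θ : ℝ) {m : ℕ} (hm : m ≤ D) :
    kappa c a b m * stdSeq c a b θ m ^ 2 ≤ sqNorm D c a b θ :=
  single_le_sum (f := fun j => kappa c a b j * stdSeq c a b θ j ^ 2)
    (fun j hj => mul_nonneg (R.kappa_pos (by rw [mem_range] at hj; omega)).le (sq_nonneg _))
    (mem_range.2 (by omega))

end MonotoneRows

/-! ### The rows of a tridiagonal sequence -/

section Rows

variable {g : ℕ}

theorem block_start_add (l : Fin (g + 1) → ℕ) (i : Fin (g + 1)) {j : ℕ} (hj : j < l i) :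
    block l (start l i + j) = i := by
  apply le_antisymm
  · refine Finset.sup_le fun k hk => ?_
    simp only [mem_filter, mem_univ, true_and] at hk
    by_contra hik
    have h1 := start_add_le l (not_le.mp hik)
    simp only [id] at h1
    omega
  · exact Finset.le_sup (f := id) (by simp)

theorem start_zero (l : Fin (g + 1) → ℕ) : start l 0 = 1 := by
  have : (Iio (0 : Fin (g + 1))) = ∅ := by
    ext x; simp
  simp [start, this]

theorem one_le_start (l : Fin (g + 1) → ℕ) (i : Fin (g + 1)) : 1 ≤ start l i := by
  simp [start]

theorem start_le_diam (l : Fin (g + 1) → ℕ) (i : Fin (g + 1)) : start l i ≤ diam l := by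
  rcases (Fin.le_last i).eq_or_lt with h | h
  · rw [h, diam]
  · have := start_add_le l h
    unfold diam
    omega

theorem start_succ (l : Fin (g + 1) → ℕ) (i : Fin g) :
    start l i.succ = start l i.castSucc + l i.castSucc := by
  have h : Iio i.succ = insert i.castSucc (Iio i.castSucc) := by
    ext x
    simp only [mem_Iio, mem_insert, Fin.lt_def, Fin.ext_iff, Fin.val_succ, Fin.val_castSucc]
    omega
  rw [start, h, sum_insert (by simp), start]
  omega

theorem block_mono (l : Fin (g + 1) → ℕ) {m n : ℕ} (h : m ≤ n) : block l m ≤ block l n := by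
  refine Finset.sup_mono fun i hi => ?_
  simp only [mem_filter, mem_univ, true_and] at hi ⊢
  omega

theorem start_block_le (l : Fin (g + 1) → ℕ) {m : ℕ} (hm : 1 ≤ m) : start l (block l m) ≤ m := by
  have hne : (univ.filter fun i => start l i ≤ m).Nonempty :=
    ⟨0, by simpa [start_zero] using hm⟩
  obtain ⟨i, hi, he⟩ := Finset.exists_mem_eq_sup _ hne (id : Fin (g + 1) → Fin (g + 1))
  rw [block, he]
  simpa using hi

theorem lt_start_block_add (l : Fin (g + 1) → ℕ) (hlast : l (Fin.last g) = 1) {m : ℕ}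
    (hm : m ≤ diam l) : m < start l (block l m) + l (block l m) := by
  by_contra hcon
  rcases Fin.eq_castSucc_or_eq_last (block l m) with ⟨i, hi⟩ | hi
  · rw [hi, ← start_succ] at hcon
    have h1 : i.succ ≤ block l m :=
      Finset.le_sup (f := id) (mem_filter.2 ⟨mem_univ _, not_lt.1 hcon⟩)
    rw [hi, Fin.le_def] at h1
    simp at h1
  · rw [hi, hlast] at hcon
    unfold diam at hm
    omega

theorem block_ne_last (l : Fin (g + 1) → ℕ) {m : ℕ} (hm1 : 1 ≤ m) (hm : m < diam l) :
    block l m ≠ Fin.last g := by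
  intro h
  have := start_block_le l hm1
  rw [h] at this
  unfold diam at hm
  omega

theorem block_diam (l : Fin (g + 1) → ℕ) (hlast : l (Fin.last g) = 1) :
    block l (diam l) = Fin.last g := by
  have := block_start_add l (Fin.last g) (j := 0) (by omega)
  simpa [diam] using this

theorem block_eq_zero (l : Fin (g + 1) → ℕ) {m : ℕ} (hm1 : 1 ≤ m) (hm : m ≤ head l) :
    block l m = 0 := by
  unfold head at hm
  have := block_start_add l 0 (j := m - 1) (by omega)
  rwa [start_zero, show 1 + (m - 1) = m by omega] at this

theorem card_rows_le (l : Fin (g + 1) → ℕ) (hlast : l (Fin.last g) = 1)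
    (I : Finset (Fin (g + 1))) (X : Finset ℕ) (hX : ∀ m ∈ X, 1 ≤ m ∧ m ≤ diam l ∧ block l m ∈ I) :
    #X ≤ ∑ i ∈ I, l i := by
  rw [card_eq_sum_card_fiberwise (f := block l) (t := I) fun m hm => (hX m hm).2.2]
  refine sum_le_sum fun i _ => ?_
  calc #{m ∈ X | block l m = i} ≤ #(Ico (start l i) (start l i + l i)) := by
        refine card_le_card fun m hm => ?_
        rw [mem_filter] at hm
        obtain ⟨h1, h2, -⟩ := hX m hm.1
        rw [mem_Ico, ← hm.2]
        exact ⟨start_block_le l h1, lt_start_block_add l hlast h2⟩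
    _ = l i := by simp

variable {κ lam : ℕ} {G : Fin (g + 1) → Triple} {l : Fin (g + 1) → ℕ}

namespace IsGraphical

theorem gam_mono (hG : IsGraphical κ lam G) : Monotone fun i => (G i).gam :=
  Fin.monotone_iff_le_succ.2 hG.gam_monotone

theorem bet_anti (hG : IsGraphical κ lam G) : Antitone fun i => (G i).bet := by
  refine Fin.antitone_iff_succ_le.2 fun i => ?_
  rcases Nat.lt_or_ge ((i : ℕ) + 1) g with h | h
  · exact hG.bet_antitone i h
  · have : i.succ = Fin.last g := by
      ext; simp; omega
    rw [this, hG.last_bet]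
    exact Nat.zero_le _

theorem mem_tripleSet' (hG : IsGraphical κ lam G) {i : Fin (g + 1)} (hi : i ≠ Fin.last g) :
    G i ∈ tripleSet κ lam := by
  obtain ⟨j, rfl⟩ := (Fin.eq_castSucc_or_eq_last i).resolve_right hi
  exact hG.mem_tripleSet j

theorem one_le_gam (hG : IsGraphical κ lam G) (i : Fin (g + 1)) : 1 ≤ (G i).gam := by
  have := hG.gam_mono (Fin.zero_le i)
  simpa [hG.first] using this

theorem one_le_bet (hG : IsGraphical κ lam G) {i : Fin (g + 1)} (hi : i ≠ Fin.last g) :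
    1 ≤ (G i).bet := (hG.mem_tripleSet' hi).1

theorem sum_eq (hG : IsGraphical κ lam G) (i : Fin (g + 1)) :
    (G i).gam + (G i).alp + (G i).bet = κ := by
  by_cases hi : i = Fin.last g
  · rw [hi, hG.last_bet, hG.last_sum, add_zero]
  · exact (hG.mem_tripleSet' hi).2.2.1

theorem zero_ne_last (hG : IsGraphical κ lam G) (hlam : lam + 2 ≤ κ) :
    (0 : Fin (g + 1)) ≠ Fin.last g := by
  intro h
  have h1 := hG.last_bet
  rw [← h, hG.first] at h1
  simp only [Triple.bet] at h1
  omega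

theorem monotoneRows (hG : IsGraphical κ lam G) (hlam : lam + 2 ≤ κ) (hl : ∀ i, 0 < l i)
    (hlast : l (Fin.last g) = 1) :
    MonotoneRows κ (diam l) (cSeq G l) (aSeq G l) (bSeq κ G l) where
  c_zero := by simp [cSeq]
  a_zero := by simp [aSeq]
  b_zero := by simp [bSeq]
  c_one := by
    rw [cSeq, if_neg one_ne_zero, tridiag, block_eq_zero l le_rfl (hl 0), hG.first]
    simp
  b_last := by
    rw [bSeq, if_neg (by have := one_le_start l (Fin.last g); unfold diam; omega), tridiag,
      block_diam l hlast, hG.last_bet, Nat.cast_zero]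
  sum_eq m _ := by
    unfold cSeq aSeq bSeq
    split_ifs
    · simp
    · exact_mod_cast hG.sum_eq (block l m)
  a_nonneg m _ := by
    unfold aSeq
    split_ifs <;> positivity
  one_le_c m hm _ := by
    rw [cSeq, if_neg (by omega)]
    exact_mod_cast hG.one_le_gam (block l m)
  one_le_b m hm := by
    unfold bSeq
    split_ifs with h
    · exact_mod_cast (by omega : 1 ≤ κ)
    · exact_mod_cast hG.one_le_bet (block_ne_last l (by omega) hm)
  c_mono m n hmn _ := by
    unfold cSeq
    split_ifs with h1 h2 h2
    · rfl
    · positivity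
    · omega
    · exact_mod_cast hG.gam_mono (block_mono l hmn)
  b_anti m n hmn _ := by
    unfold bSeq
    split_ifs with h1 h2 h2
    · rfl
    · omega
    · have := hG.sum_eq (block l n)
      exact_mod_cast (by omega : (G (block l n)).bet ≤ κ)
    · exact_mod_cast hG.bet_anti (block_mono l hmn)
  one_le_D := one_le_start l _
  one_le_κ := by exact_mod_cast (by omega : 1 ≤ κ)

/-- A term of a graphical sequence other than the head, the tail and the last term has a spectral
interval that extends to the right of the one of the head. -/
theorem abs_sqrt_sub_lt (hG : IsGraphical κ lam G) (hlam : lam + 2 ≤ κ) {i : Fin (g + 1)}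
    (hi0 : i ≠ 0) (hi : i ≠ Fin.last g) (htail : G i ≠ (κ - lam - 1, lam, 1)) :
    |√((G i).bet : ℝ) - √((G i).gam : ℝ)| < √((κ - lam - 1 : ℕ) : ℝ) - 1 := by
  obtain ⟨h1, h2, h3, h4, h5⟩ := hG.mem_tripleSet' hi
  have hhead : G i ≠ (1, lam, κ - lam - 1) := fun h => hi0 (hG.distinct (h.trans hG.first.symm))
  -- The conditions defining `tripleSet` bound `β` and `γ` by `κ - λ - 1`, and both are at least 1.
  -- Equality in either bound of the claim would force the head triple or the tail triple.
  have hb : (G i).bet ≤ κ - lam - 1 := by omega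
  have hc : (G i).gam ≤ κ - lam - 1 := by omega
  have e1 := Real.sqrt_le_sqrt (Nat.cast_le (α := ℝ) |>.2 hb)
  have e2 := Real.sqrt_le_sqrt (Nat.cast_le (α := ℝ) |>.2 hc)
  have f1 : 1 ≤ √((G i).bet : ℝ) := Real.one_le_sqrt.2 (by exact_mod_cast h1)
  have f2 : 1 ≤ √((G i).gam : ℝ) := Real.one_le_sqrt.2 (by exact_mod_cast h2)
  rw [abs_lt]
  constructor
  · by_contra hcon
    have g1 : √((G i).bet : ℝ) = 1 := by linarith
    have g2 : √((G i).gam : ℝ) = √((κ - lam - 1 : ℕ) : ℝ) := by linarith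
    rw [Real.sqrt_eq_one] at g1
    rw [Real.sqrt_inj (by positivity) (by positivity)] at g2
    have g3 : (G i).bet = 1 := by exact_mod_cast g1
    have g4 : (G i).gam = κ - lam - 1 := by exact_mod_cast g2
    have g5 : (G i).alp = lam := by omega
    exact htail (by rw [← g4, ← g5, ← g3])
  · by_contra hcon
    have g1 : √((G i).gam : ℝ) = 1 := by linarith
    have g2 : √((G i).bet : ℝ) = √((κ - lam - 1 : ℕ) : ℝ) := by linarith
    rw [Real.sqrt_eq_one] at g1
    rw [Real.sqrt_inj (by positivity) (by positivity)] at g2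
    have g3 : (G i).gam = 1 := by exact_mod_cast g1
    have g4 : (G i).bet = κ - lam - 1 := by exact_mod_cast g2
    have g5 : (G i).alp = lam := by omega
    exact hhead (by rw [← g4, ← g5, ← g3])

end IsGraphical

/-- The positions outside of the head and the tail belong to the remaining blocks. -/
theorem diam_le_head_add_tail_add (hlast : l (Fin.last g) = 1) :
    diam l ≤ head l + tail κ lam G l + 1 +
      ∑ i with i ≠ 0 ∧ i ≠ Fin.last g ∧ G i ≠ (κ - lam - 1, lam, 1), l i := by
  classical
  set I : Finset (Fin (g + 1)) :=
    {i | i ≠ 0 ∧ i ≠ Fin.last g ∧ G i ≠ (κ - lam - 1, lam, 1)} with hI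
  set X := (Ioc (head l) (diam l)).filter fun m => block l m ∈ I with hX
  have hcardX : #X ≤ ∑ i ∈ I, l i := by
    refine card_rows_le l hlast I X fun m hm => ?_
    rw [hX, mem_filter, mem_Ioc] at hm
    exact ⟨by omega, hm.1.2, hm.2⟩
  have hcover : Ioc (head l) (diam l) ⊆
      ((Ioc (head l) (diam l)).filter fun m => tridiag G l m = (κ - lam - 1, lam, 1)) ∪
        (X ∪ {diam l}) := by
    intro m hm
    simp only [mem_union, mem_filter, mem_singleton, hX]
    rw [mem_Ioc] at hm
    by_cases h1 : m = diam l
    · exact Or.inr (Or.inr h1)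
    by_cases h2 : tridiag G l m = (κ - lam - 1, lam, 1)
    · exact Or.inl ⟨mem_Ioc.2 hm, h2⟩
    refine Or.inr (Or.inl ⟨mem_Ioc.2 hm, ?_⟩)
    rw [hI, mem_filter]
    refine ⟨mem_univ _, fun h0 => ?_, block_ne_last l (by omega) (by omega), h2⟩
    have h3 := lt_start_block_add l hlast hm.2
    rw [h0, start_zero] at h3
    unfold head at hm
    omega
  have h1 := card_le_card hcover
  have h2 := card_union_le ((Ioc (head l) (diam l)).filter
    fun m => tridiag G l m = (κ - lam - 1, lam, 1)) (X ∪ {diam l})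
  have h3 := card_union_le X {diam l}
  rw [Nat.card_Ioc] at h1
  rw [card_singleton] at h3
  unfold tail
  omega

end Rows

/-! ### Zones of growth, oscillation and decay for a graphical sequence -/

section Zones

variable {g κ lam : ℕ} {G : Fin (g + 1) → Triple} {l : Fin (g + 1) → ℕ}

/-- The blocks all of whose rows have a spectral interval to the right of `κ - σ²`. -/
noncomputable def shortBlocks (G : Fin (g + 1) → Triple) (σ : ℝ) : Finset (Fin (g + 1)) :=
  {i | i ≠ Fin.last g ∧ |√((G i).bet : ℝ) - √((G i).gam : ℝ)| < σ ∧
    √((G i).bet : ℝ) + √((G i).gam : ℝ) < σ}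

/-- The weights of the rows that count the factors by which the energy may change. -/
noncomputable def rowWeight (G : Fin (g + 1) → Triple) (l : Fin (g + 1) → ℕ) (σ : ℝ) (m : ℕ) : ℕ :=
  (if m = start l (block l m) then 2 else 0) +
    -- Row 0 belongs to no block; `block l 0` is only the default value of an empty supremum.
    if 1 ≤ m ∧ block l m ∈ shortBlocks G σ then 1 else 0

theorem sum_rowWeight_le (hlast : l (Fin.last g) = 1) (σ : ℝ) :
    ∑ m ∈ range (diam l), rowWeight G l σ m ≤ 2 * (g + 1) + ∑ i ∈ shortBlocks G σ, l i := by
  simp only [rowWeight]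
  rw [sum_add_distrib, ← sum_filter, ← sum_filter, sum_const, sum_const, smul_eq_mul, smul_eq_mul,
    mul_one, mul_comm]
  refine add_le_add (Nat.mul_le_mul_left _ ?_) (card_rows_le l hlast _ _ fun m hm => ?_)
  · calc _ ≤ #(univ.image (start l)) := by
          refine card_le_card fun m hm => ?_
          rw [mem_filter] at hm
          exact mem_image.2 ⟨_, mem_univ _, hm.2.symm⟩
      _ ≤ #(univ : Finset (Fin (g + 1))) := card_image_le
      _ = g + 1 := by simp
  · rw [mem_filter, mem_range] at hm
    exact ⟨hm.2.1, hm.1.le, hm.2.2⟩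

theorem cSeq_eq {m : ℕ} (hm : 1 ≤ m) : cSeq G l m = (G (block l m)).gam := by
  rw [cSeq, if_neg (by omega), tridiag]

theorem bSeq_eq {m : ℕ} (hm : 1 ≤ m) : bSeq κ G l m = (G (block l m)).bet := by
  rw [bSeq, if_neg (by omega), tridiag]

/-- This translates the position of `s` between the edges of a spectral interval into the
discriminant condition of `energy_block`. -/
theorem sq_sub_mul_sub_sq {β γ : ℝ} (hβ : 0 ≤ β) (hγ : 0 ≤ γ) (s : ℝ) :
    (s ^ 2 - (√β - √γ) ^ 2) * ((√β + √γ) ^ 2 - s ^ 2) = 4 * (β * γ) - (β + γ - s ^ 2) ^ 2 := by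
  have h1 := Real.sq_sqrt hβ
  have h2 := Real.sq_sqrt hγ
  set p := √β
  set q := √γ
  rw [← h1, ← h2]
  ring

/-- The norm of an eigenvector is governed by its value at the end of the zone of growth. -/
theorem IsGraphical.exists_sqNorm_le (hG : IsGraphical κ lam G) (hlam : lam + 2 ≤ κ)
    (hl : ∀ i, 0 < l i) (hlast : l (Fin.last g) = 1) {σ f K : ℝ} (hσ0 : 0 < σ)
    (hσ : σ ≤ √((κ - lam - 1 : ℕ) : ℝ) - 1) (hf : 0 < f) (hK : stepConst κ ≤ K)
    (hKf : 16 * (κ : ℝ) ^ 2 / f ≤ K) :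
    ∃ M, head l ≤ M ∧ M < diam l ∧ σ ≤ √(bSeq κ G l M) - √(cSeq G l M) ∧
      ∀ s θ : ℝ, 0 ≤ s → s ≤ σ → θ = κ - s ^ 2 →
        (∀ i, i ≠ Fin.last g → |√((G i).bet : ℝ) - √((G i).gam : ℝ)| < σ →
          σ ≤ √((G i).bet : ℝ) + √((G i).gam : ℝ) →
          f ≤ (s ^ 2 - (√((G i).bet : ℝ) - √((G i).gam : ℝ)) ^ 2) *
            ((√((G i).bet : ℝ) + √((G i).gam : ℝ)) ^ 2 - s ^ 2)) →
        IsEigenvalue κ G l θ →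
        sqNorm (diam l) (cSeq G l) (aSeq G l) (bSeq κ G l) θ ≤
          (diam l + 1) * (K ^ (2 * (g + 1) + ∑ i ∈ shortBlocks G σ, l i + 3) *
            (kappa (cSeq G l) (aSeq G l) (bSeq κ G l) (M + 1) *
              stdSeq (cSeq G l) (aSeq G l) (bSeq κ G l) θ (M + 1) ^ 2)) := by
  classical
  have R := hG.monotoneRows hlam hl hlast
  set D := diam l with hD
  set b := bSeq κ G l with hb
  set c := cSeq G l with hc
  set a := aSeq G l with ha
  have hheadD : head l < D := by
    have := start_add_le l (lt_of_le_of_ne (Fin.zero_le _) (hG.zero_ne_last hlam))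
    rw [start_zero] at this
    unfold head diam at *
    omega
  have hhead1 : 1 ≤ head l := hl 0
  -- The last row of the growth zone. It depends on `σ` only and not on `θ`, so that two eigenvalues
  -- can later be compared at the same position.
  set M := Nat.findGreatest (fun m => σ ≤ √(b m) - √(c m)) D with hM
  have hhead : σ ≤ √(b (head l)) - √(c (head l)) := by
    rw [hb, hc, bSeq_eq hhead1, cSeq_eq hhead1, block_eq_zero l hhead1 le_rfl, hG.first]
    change σ ≤ √((κ - lam - 1 : ℕ) : ℝ) - √((1 : ℕ) : ℝ)
    rwa [Nat.cast_one, Real.sqrt_one]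
  have hMhead : head l ≤ M := Nat.le_findGreatest hheadD.le hhead
  have hMini : σ ≤ √(b M) - √(c M) :=
    Nat.findGreatest_spec (P := fun m => σ ≤ √(b m) - √(c m)) hheadD.le hhead
  have hMle : M ≤ D := Nat.findGreatest_le D
  have hMD : M < D := by
    refine lt_of_le_of_ne hMle fun h => ?_
    rw [h, R.b_last, Real.sqrt_zero] at hMini
    linarith [Real.sqrt_nonneg (c D)]
  -- The final zone starts where `√c - √b` reaches `σ`; if this does not happen after `M` and before
  -- `D`, it is taken to start at `D`.
  have hexN : ∃ m, M < m ∧ m ≤ D ∧ (σ ≤ √(c m) - √(b m) ∨ m = D) := ⟨D, hMD, le_rfl, Or.inr rfl⟩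
  set N := Nat.find hexN with hN
  obtain ⟨hMN, hND, hNfin⟩ := Nat.find_spec hexN
  refine ⟨M, hMhead, hMD, hMini, ?_⟩
  intro s θ hs hsσ hθ hwell heig
  have hend := R.last_row_of_hasEigenvalue heig
  have hσκ : s ^ 2 ≤ κ := by
    have h1 : ((κ - lam - 1 : ℕ) : ℝ) ≤ κ := by exact_mod_cast (by omega : κ - lam - 1 ≤ κ)
    have h2 : s ≤ √((κ - lam - 1 : ℕ) : ℝ) := by linarith
    have h3 := pow_le_pow_left₀ hs h2 2
    rw [Real.sq_sqrt (by positivity)] at h3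
    linarith
  have hKone : 1 ≤ K := by
    have h1 := R.one_le_κ
    refine le_trans ?_ hK
    unfold stepConst
    nlinarith [mul_nonneg (by linarith : 0 ≤ (κ : ℝ)) (sq_nonneg (κ : ℝ))]
  have hmain := R.sqNorm_le hs hθ (by linarith) hend (M := M) (N := N) (by omega) hMN hND
    (hsσ.trans hMini) (fun m hNm hmD => ?_) hK (w := rowWeight G l σ) (fun m hMm hmN => ?_)
  · refine hmain.trans (mul_le_mul_of_nonneg_left (mul_le_mul_of_nonneg_right ?_ ?_)
      (by positivity))
    · exact pow_le_pow_right₀ hKone (Nat.add_le_add_right (sum_rowWeight_le hlast σ) 3)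
    · exact mul_nonneg (R.kappa_pos (by omega)).le (sq_nonneg _)
  · rcases hNfin with h | h
    · have h1 := Real.sqrt_le_sqrt (R.c_mono N m hNm hmD.le)
      have h2 := Real.sqrt_le_sqrt (R.b_anti N m hNm hmD.le)
      linarith
    · omega
  · have hmD : m < D := by omega
    have hm1 : 1 ≤ m := by omega
    have hnini : ¬ σ ≤ √(b m) - √(c m) :=
      Nat.findGreatest_is_greatest (P := fun m => σ ≤ √(b m) - √(c m)) hMm hmD.le
    have hnfin : ¬ σ ≤ √(c m) - √(b m) := fun h =>
      Nat.find_min hexN hmN ⟨hMm, hmD.le, Or.inl h⟩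
    have hil := block_ne_last l hm1 hmD
    have hSm := start_block_le l hm1
    have hmS := lt_start_block_add l hlast hmD.le
    have hbm : b m = (G (block l m)).bet := bSeq_eq hm1
    have hcm : c m = (G (block l m)).gam := cSeq_eq hm1
    set i := block l m with hi
    have habs : |√((G i).bet : ℝ) - √((G i).gam : ℝ)| < σ := by
      rw [← hbm, ← hcm, abs_lt]
      constructor <;> linarith
    by_cases hshort : √((G i).bet : ℝ) + √((G i).gam : ℝ) < σ
    · left
      have : i ∈ shortBlocks G σ := by
        rw [shortBlocks, mem_filter]
        exact ⟨mem_univ _, hil, habs, hshort⟩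
      rw [rowWeight, if_pos (⟨hm1, this⟩ : 1 ≤ m ∧ block l m ∈ shortBlocks G σ)]
      omega
    · right
      rw [not_lt] at hshort
      have hSblock : ∀ n, start l i ≤ n → n < start l i + l i → block l n = i := by
        intro n h1 h2
        have := block_start_add l i (j := n - start l i) (by omega)
        rwa [show start l i + (n - start l i) = n by omega] at this
      have hS1 := one_le_start l i
      have hblock : ∀ n, start l i ≤ n → n < start l i + l i →
          b n = (G i).bet ∧ c n = (G i).gam := by
        intro n h1 h2
        rw [hb, hc, bSeq_eq (by omega), cSeq_eq (by omega), hSblock n h1 h2]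
        exact ⟨rfl, rfl⟩
      refine ⟨start l i, ?_, hSm, ?_, ?_⟩
      · by_contra hcon
        refine hnini ?_
        have h1 := R.sqrt_sub_antitone (not_lt.1 hcon) hMD.le
        obtain ⟨h2, h3⟩ := hblock _ le_rfl (by have := hl i; omega)
        rw [hbm, hcm, ← h2, ← h3]
        linarith
      · rw [rowWeight, hSblock _ le_rfl (by have := hl i; omega), if_pos rfl]
        omega
      · have hw := hwell i hil habs hshort
        rw [sq_sub_mul_sub_sq (by positivity) (by positivity)] at hw
        have hstart : start l i + l i ≤ D :=
          start_add_le l (lt_of_le_of_ne (Fin.le_last i) hil)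
        have h1 := R.energy_block (θ := θ) hf (β := (G i).bet) (γ := (G i).gam)
          (by rw [show (κ : ℝ) - θ = s ^ 2 by linarith]; exact hw) (by positivity) hstart hblock
          (j := m - start l i) (by omega)
        rw [show start l i + (m - start l i) = m by omega] at h1
        exact h1.trans (mul_le_mul_of_nonneg_right hKf
          (R.energy_nonneg θ (start_le_diam l i)))

/-- Two eigenvalues with equal norms of the eigenvectors are close if the head is long. -/
theorem IsGraphical.pow_head_le (hG : IsGraphical κ lam G) (hlam : lam + 2 ≤ κ)
    (hl : ∀ i, 0 < l i) (hlast : l (Fin.last g) = 1) {σ s₁ s₂ f K : ℝ} (hs₁ : 0 ≤ s₁)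
    (hs₁₂ : s₁ ≤ s₂) (hs₂ : s₂ ≤ σ) (hσ0 : 0 < σ)
    (hσ : σ ≤ √((κ - lam - 1 : ℕ) : ℝ) - 1) (hf : 0 < f) (hK : stepConst κ ≤ K)
    (hKf : 16 * (κ : ℝ) ^ 2 / f ≤ K)
    (hwell : ∀ i, i ≠ Fin.last g → |√((G i).bet : ℝ) - √((G i).gam : ℝ)| < σ →
      σ ≤ √((G i).bet : ℝ) + √((G i).gam : ℝ) → ∀ s, s₁ ≤ s → s ≤ s₂ →
      f ≤ (s ^ 2 - (√((G i).bet : ℝ) - √((G i).gam : ℝ)) ^ 2) *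
        ((√((G i).bet : ℝ) + √((G i).gam : ℝ)) ^ 2 - s ^ 2)) {θ θ' : ℝ}
    (h₁ : κ - s₂ ^ 2 ≤ θ) (hle : θ ≤ θ') (h₂ : θ' ≤ κ - s₁ ^ 2) (he : IsEigenvalue κ G l θ)
    (hch : christoffelNumber κ G l θ = christoffelNumber κ G l θ') :
    (1 + (θ' - θ) / κ) ^ (2 * head l) ≤
      (diam l + 1) * K ^ (2 * (g + 1) + ∑ i ∈ shortBlocks G σ, l i + 3) := by
  have R := hG.monotoneRows hlam hl hlast
  obtain ⟨M, hM1, hMD, hM, hbound⟩ := hG.exists_sqNorm_le hlam hl hlast hσ0 hσ hf hK hKf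
  have hsq : ∀ ξ : ℝ, κ - s₂ ^ 2 ≤ ξ → ξ ≤ κ - s₁ ^ 2 → ∃ s, s₁ ≤ s ∧ s ≤ s₂ ∧ ξ = κ - s ^ 2 := by
    intro ξ h h'
    refine ⟨√(κ - ξ), Real.le_sqrt_of_sq_le (by linarith), ?_, ?_⟩
    · exact (Real.sqrt_le_left (hs₁.trans hs₁₂)).2 (by linarith)
    · rw [Real.sq_sqrt (by linarith [sq_nonneg s₁])]
      ring
  obtain ⟨s, hs1, hs2, hθ⟩ := hsq θ h₁ (hle.trans h₂)
  obtain ⟨s', hs1', hs2', hθ'⟩ := hsq θ' (h₁.trans hle) h₂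
  have hhead := hl 0
  have hhead' : 1 ≤ head l := hhead
  have hup := hbound s θ (by linarith) (by linarith) hθ
    (fun i h h' h'' => hwell i h h' h'' s hs1 hs2) he
  have hcmp := R.forward_compare (s := s) (s' := s') (by linarith) (by linarith) hθ hθ' hle
    (M := M) (by omega) hMD (by linarith) (by linarith)
  have hpos := R.forward_pos (s := s) (by linarith) hθ (M := M) (by omega) hMD (by linarith)
    (m := M + 1) le_rfl
  have hlow := R.le_sqNorm θ' (m := M + 1) hMD
  -- Equal norms link a lower bound for `θ'`, by a single term, to the upper bound for `θ` in terms
  -- of its value at the same position.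
  rw [← R.sqNorm_eq_of_christoffel_eq θ hch] at hlow
  have hk := R.kappa_pos (m := M + 1) hMD
  set y := stdSeq (cSeq G l) (aSeq G l) (bSeq κ G l) θ (M + 1) with hy
  set k := kappa (cSeq G l) (aSeq G l) (bSeq κ G l) (M + 1) with hk'
  have hκ := R.one_le_κ
  set u := 1 + (θ' - θ) / (κ : ℝ) with hu
  have hu1 : 1 ≤ u := by
    have : 0 ≤ (θ' - θ) / (κ : ℝ) := div_nonneg (by linarith) (by linarith)
    linarith
  have hcmp2 := pow_le_pow_left₀ (mul_nonneg (by positivity) hpos.le) hcmp 2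
  rw [mul_pow, ← pow_mul] at hcmp2
  have hY : 0 < k * y ^ 2 := by positivity
  refine le_of_mul_le_mul_right ?_ hY
  -- The growth zone contains the head, so `head l ≤ M + 1`.
  calc u ^ (2 * head l) * (k * y ^ 2) ≤ u ^ ((M + 1) * 2) * (k * y ^ 2) := by
        refine mul_le_mul_of_nonneg_right (pow_le_pow_right₀ hu1 (by omega)) hY.le
    _ = k * (u ^ ((M + 1) * 2) * y ^ 2) := by ring
    _ ≤ k * stdSeq (cSeq G l) (aSeq G l) (bSeq κ G l) θ' (M + 1) ^ 2 :=
        mul_le_mul_of_nonneg_left hcmp2 hk.le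
    _ ≤ _ := hlow
    _ ≤ _ := hup
    _ = _ := by ring

end Zones

theorem exists_pos_le_of_finite {ι : Type*} [Finite ι] (p : ι → Prop) (u : ι → ℝ)
    (h : ∀ i, p i → 0 < u i) : ∃ f : ℝ, 0 < f ∧ ∀ i, p i → f ≤ u i := by
  classical
  cases nonempty_fintype ι
  by_cases hne : (univ.filter p).Nonempty
  · obtain ⟨i, hi, hmin⟩ := exists_min_image _ u hne
    exact ⟨u i, h i (mem_filter.1 hi).2, fun j hj => hmin j (mem_filter.2 ⟨mem_univ _, hj⟩)⟩
  · exact ⟨1, one_pos, fun i hi => absurd ⟨i, mem_filter.2 ⟨mem_univ _, hi⟩⟩ hne⟩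

/-- Exponential growth beats linear growth. -/
theorem exists_bound_of_pow_le {u : ℝ} (hu : 1 < u) (A : ℝ) :
    ∃ H : ℝ, ∀ h : ℕ, 1 ≤ h → u ^ h ≤ A * h → (h : ℝ) ≤ H := by
  have ht := tendsto_pow_const_div_const_pow_of_one_lt 1 hu
  have hev := ht.eventually (gt_mem_nhds (show (0 : ℝ) < 1 / (|A| + 1) by positivity))
  obtain ⟨n, hn⟩ := Filter.eventually_atTop.1 hev
  refine ⟨n, fun h hh hle => ?_⟩
  by_contra hcon
  have h1 := hn h (by exact_mod_cast (not_le.1 hcon).le)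
  rw [pow_one, div_lt_div_iff₀ (by positivity) (by positivity)] at h1
  have h2 : A * h ≤ |A| * h := mul_le_mul_of_nonneg_right (le_abs_self A) (by positivity)
  have h3 : (1 : ℝ) ≤ h := by exact_mod_cast hh
  nlinarith

/-! ### Bounding the head when some intermediate block is long -/

section Bound

variable {g κ lam : ℕ} {G : Fin (g + 1) → Triple}

/-- The choice of an interval inside of the spectral interval of the block `i₀`. -/
theorem IsGraphical.exists_interval (hG : IsGraphical κ lam G) {i₀ : Fin (g + 1)}
    (hi₀ : i₀ ≠ Fin.last g)
    (hmid : |√((G i₀).bet : ℝ) - √((G i₀).gam : ℝ)| < √((κ - lam - 1 : ℕ) : ℝ) - 1) :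
    ∃ σ s₁ s₂ f : ℝ, 0 < σ ∧ σ ≤ √((G i₀).bet : ℝ) + √((G i₀).gam : ℝ) ∧
      σ ≤ √((κ - lam - 1 : ℕ) : ℝ) - 1 ∧ 0 < s₁ ∧ s₁ < s₂ ∧ s₂ < σ ∧
      |√((G i₀).bet : ℝ) - √((G i₀).gam : ℝ)| < s₁ ∧ 0 < f ∧
      ∀ i, i ≠ Fin.last g → |√((G i).bet : ℝ) - √((G i).gam : ℝ)| < σ →
        σ ≤ √((G i).bet : ℝ) + √((G i).gam : ℝ) → ∀ s, s₁ ≤ s → s ≤ s₂ →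
        f ≤ (s ^ 2 - (√((G i).bet : ℝ) - √((G i).gam : ℝ)) ^ 2) *
          ((√((G i).bet : ℝ) + √((G i).gam : ℝ)) ^ 2 - s ^ 2) := by
  set p : Fin (g + 1) → ℝ := fun i => √((G i).bet : ℝ) with hp
  set q : Fin (g + 1) → ℝ := fun i => √((G i).gam : ℝ) with hq
  have hp1 : 1 ≤ p i₀ := Real.one_le_sqrt.2 (by exact_mod_cast hG.one_le_bet hi₀)
  have hq1 : 1 ≤ q i₀ := Real.one_le_sqrt.2 (by exact_mod_cast hG.one_le_gam i₀)
  -- The first bound keeps `κ - s²`, for `s < σ`, to the right of the left edge of block `i₀`; the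
  -- second keeps the head in the growth zone.
  set σ := min (p i₀ + q i₀) (√((κ - lam - 1 : ℕ) : ℝ) - 1) with hσdef
  have hσ1 : σ ≤ p i₀ + q i₀ := min_le_left _ _
  have hσ2 : σ ≤ √((κ - lam - 1 : ℕ) : ℝ) - 1 := min_le_right _ _
  have hi₀σ : |p i₀ - q i₀| < σ := by
    refine lt_min ?_ hmid
    rw [abs_lt]
    constructor <;> linarith
  have hσ0 : 0 < σ := lt_of_le_of_lt (abs_nonneg _) hi₀σ
  -- `η₀` is a gap between `σ` and all values `|√β - √γ|` below it. Placing `s₁` and `s₂` within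
  -- this gap makes every block with such a value and `√β + √γ ≥ σ` oscillate uniformly.
  obtain ⟨η₀, hη₀, hη₀'⟩ := exists_pos_le_of_finite (fun i => |p i - q i| < σ)
    (fun i => σ - |p i - q i|) (fun i hi => sub_pos.2 hi)
  set η := min η₀ σ with hη
  have hηpos : 0 < η := lt_min hη₀ hσ0
  have hησ : η ≤ σ := min_le_right _ _
  set s₁ := σ - η / 2 with hs₁
  set s₂ := σ - η / 4 with hs₂
  have hs₁0 : 0 < s₁ := by linarith
  have hs₁₂ : s₁ < s₂ := by linarith
  have hs₂σ : s₂ < σ := by linarith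
  have hs₁i : ∀ i, |p i - q i| < σ → |p i - q i| < s₁ := fun i hi => by
    have := hη₀' i hi
    have := min_le_left η₀ σ
    linarith
  have hpos2 : ∀ i, |p i - q i| < σ → σ ≤ p i + q i →
      0 < (s₁ ^ 2 - (p i - q i) ^ 2) * ((p i + q i) ^ 2 - s₂ ^ 2) := fun i h h' => by
    refine mul_pos (sub_pos.2 ?_) (sub_pos.2 ?_)
    · exact sq_lt_sq' (by linarith [(abs_lt.1 (hs₁i i h)).1]) (abs_lt.1 (hs₁i i h)).2
    · exact pow_lt_pow_left₀ (by linarith) (by linarith) two_ne_zero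
  obtain ⟨f, hf, hf'⟩ := exists_pos_le_of_finite (fun i => |p i - q i| < σ ∧ σ ≤ p i + q i)
    (fun i => (s₁ ^ 2 - (p i - q i) ^ 2) * ((p i + q i) ^ 2 - s₂ ^ 2))
    (fun i hi => hpos2 i hi.1 hi.2)
  have hwell : ∀ i, i ≠ Fin.last g → |p i - q i| < σ → σ ≤ p i + q i → ∀ s, s₁ ≤ s → s ≤ s₂ →
      f ≤ (s ^ 2 - (p i - q i) ^ 2) * ((p i + q i) ^ 2 - s ^ 2) := by
    intro i _ h h' s h1 h2
    -- The first factor is smallest at `s₁` and the second at `s₂`.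
    refine (hf' i ⟨h, h'⟩).trans (mul_le_mul ?_ ?_ ?_ ?_)
    · linarith [pow_le_pow_left₀ hs₁0.le h1 2]
    · linarith [pow_le_pow_left₀ (by linarith) h2 2]
    · linarith [pow_le_pow_left₀ (by linarith : 0 ≤ s₂) (by linarith : s₂ ≤ p i + q i) 2]
    · have := sq_lt_sq' (by linarith [(abs_lt.1 (hs₁i i h)).1]) (abs_lt.1 (hs₁i i h)).2
      linarith [pow_le_pow_left₀ hs₁0.le h1 2]
  exact ⟨σ, s₁, s₂, f, hσ0, hσ1, hσ2, hs₁0, hs₁₂, hs₂σ, hs₁i i₀ hi₀σ, hf, hwell⟩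

/-- A long block produces many eigenvalues in each interval inside of its spectral interval. -/
theorem IsGraphical.exists_eigenvalues (hG : IsGraphical κ lam G) (hlam : lam + 2 ≤ κ)
    {i₀ : Fin (g + 1)} (hi₀ : i₀ ≠ Fin.last g) {s₁ s₂ : ℝ}
    (h₁ : |√((G i₀).bet : ℝ) - √((G i₀).gam : ℝ)| < s₁) (hs₁₂ : s₁ < s₂)
    (h₂ : s₂ < √((G i₀).bet : ℝ) + √((G i₀).gam : ℝ)) :
    ∃ N : ℕ, ∀ l : Fin (g + 1) → ℕ, (∀ i, 0 < l i) → l (Fin.last g) = 1 →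
      ∃ S : Finset ℝ, (∀ x ∈ S, IsEigenvalue κ G l x ∧ κ - s₂ ^ 2 ≤ x ∧ x ≤ κ - s₁ ^ 2) ∧
        (l i₀ : ℝ) < (#S + 1) * (N + 2) := by
  set p : ℝ := √((G i₀).bet : ℝ) with hp
  set q : ℝ := √((G i₀).gam : ℝ) with hq
  have hp1 : 1 ≤ p := Real.one_le_sqrt.2 (by exact_mod_cast hG.one_le_bet hi₀)
  have hq1 : 1 ≤ q := Real.one_le_sqrt.2 (by exact_mod_cast hG.one_le_gam i₀)
  have hs₁0 : 0 < s₁ := lt_of_le_of_lt (abs_nonneg _) h₁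
  obtain ⟨h₁a, h₁b⟩ := abs_lt.1 h₁
  -- The interval from `κ - s₂²` to `κ - s₁²` has centre `κ - τ` and radius `r`.
  set τ := (s₁ ^ 2 + s₂ ^ 2) / 2 with hτ
  set r := (s₂ ^ 2 - s₁ ^ 2) / 2 with hr
  have hsq12 : s₁ ^ 2 < s₂ ^ 2 := pow_lt_pow_left₀ hs₁₂ hs₁0.le two_ne_zero
  have hr0 : 0 < r := by rw [hr]; linarith
  set β : ℝ := ((G i₀).bet : ℝ) with hβ
  set γ : ℝ := ((G i₀).gam : ℝ) with hγ
  have hpβ : p ^ 2 = β := Real.sq_sqrt (by positivity)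
  have hqγ : q ^ 2 = γ := Real.sq_sqrt (by positivity)
  have hsqrt : √(β * γ) = p * q := Real.sqrt_mul (by positivity) _
  set t := (β + γ - τ) / (2 * √(β * γ)) with ht
  have hpq : 0 < p * q := by positivity
  have htτ : κ - β - γ + 2 * t * √(β * γ) = κ - τ := by
    rw [ht, hsqrt]
    field_simp
    ring
  have ht1 : |t| < 1 := by
    have h3 : (p - q) ^ 2 < s₁ ^ 2 := sq_lt_sq' (by linarith) h₁b
    have h4 : s₂ ^ 2 < (p + q) ^ 2 := pow_lt_pow_left₀ h₂ (by linarith) two_ne_zero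
    rw [ht, hsqrt, abs_lt, lt_div_iff₀ (by positivity), div_lt_iff₀ (by positivity), ← hpβ, ← hqγ]
    constructor <;> nlinarith
  -- The windows are made long enough for residual `r`. Only the block triple and the interval
  -- enter, so `N` is uniform in `l`.
  obtain ⟨N₀, hN₀⟩ := exists_nat_ge (4 * (β * γ) * (1 + 1 / (1 - |t|)) / r ^ 2)
  set N := N₀ + 1 with hN
  have hres : 4 * (β * γ) * (1 + 1 / (1 - |t|)) ≤ r ^ 2 * N := by
    rw [div_le_iff₀ (by positivity)] at hN₀
    have : (N : ℝ) = N₀ + 1 := by rw [hN]; push_cast; ring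
    rw [this]
    nlinarith [sq_nonneg r]
  refine ⟨N, fun l hl hlast => ?_⟩
  have R := hG.monotoneRows hlam hl hlast
  have hblock : ∀ m, start l i₀ ≤ m → m < start l i₀ + l i₀ →
      bSeq κ G l m = β ∧ cSeq G l m = γ := by
    intro m h1 h2
    have hs1 := one_le_start l i₀
    have := block_start_add l i₀ (j := m - start l i₀) (by omega)
    rw [show start l i₀ + (m - start l i₀) = m by omega] at this
    rw [bSeq_eq (by omega), cSeq_eq (by omega), this]
    exact ⟨rfl, rfl⟩
  set k := l i₀ / (N + 2) with hk
  have hcount := R.le_card_eigenvalues_of_block (one_le_start l i₀)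
    (start_add_le l (lt_of_le_of_ne (Fin.le_last i₀) hi₀)) hblock (by positivity) ht1 hr0.le
    (by omega) hres (Nat.div_mul_le_self (l i₀) (N + 2))
  rw [htτ] at hcount
  set ev := (symMatrix_isHermitian (diam l) (cSeq G l) (aSeq G l) (bSeq κ G l)).eigenvalues with hev
  set S : Finset ℝ := ({j | |ev j - (κ - τ)| ≤ r} : Finset _).image ev with hS
  have hScard : k ≤ #S := by
    rw [hS, card_image_of_injective _ R.eigenvalues_injective]
    exact hcount
  refine ⟨S, ?_, ?_⟩
  · intro x hx
    obtain ⟨j, hj, rfl⟩ := mem_image.1 hx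
    rw [mem_filter, abs_le] at hj
    refine ⟨hasEigenvalue_iff_mem_roots.2 ?_, by linarith [hj.2.1], by linarith [hj.2.2]⟩
    rw [R.roots_charpoly]
    exact Multiset.mem_map_of_mem _ (mem_univ_val j)
  · have h4 : l i₀ < (#S + 1) * (N + 2) :=
      (Nat.div_lt_iff_lt_mul (Nat.succ_pos _)).1 (Nat.lt_succ_of_le hScard)
    exact_mod_cast h4

/-- If a block whose spectral interval extends to the right of the one of the head is long, while
the blocks with a smaller value of `√β + √γ` are very short, then the head is bounded. -/
theorem IsGraphical.head_bounded_of_short (hG : IsGraphical κ lam G) (hlam : lam + 2 ≤ κ)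
    {C : ℝ} (hC : 0 < C) {i₀ : Fin (g + 1)} (hi₀ : i₀ ≠ Fin.last g)
    (hmid : |√((G i₀).bet : ℝ) - √((G i₀).gam : ℝ)| < √((κ - lam - 1 : ℕ) : ℝ) - 1) {e : ℝ}
    (he : 0 < e) :
    ∃ e' : ℝ, 0 < e' ∧ ∃ H : ℝ, ∀ l : Fin (g + 1) → ℕ, (∀ i, 0 < l i) → l (Fin.last g) = 1 →
      PropertyAC κ G l → (diam l : ℝ) ≤ C * head l → e * head l ≤ l i₀ →
      (∀ i, i ≠ Fin.last g →
        |√((G i).bet : ℝ) - √((G i).gam : ℝ)| < √((κ - lam - 1 : ℕ) : ℝ) - 1 →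
        √((G i).bet : ℝ) + √((G i).gam : ℝ) < √((G i₀).bet : ℝ) + √((G i₀).gam : ℝ) →
        (l i : ℝ) ≤ e' * head l) →
      (head l : ℝ) ≤ H := by
  have hκ1 : (1 : ℝ) ≤ κ := by exact_mod_cast (by omega : 1 ≤ κ)
  obtain ⟨σ, s₁, s₂, f, hσ0, hσ1, hσ2, hs₁0, hs₁₂, hs₂σ, hi₀σ, hf, hwell⟩ :=
    hG.exists_interval hi₀ hmid
  obtain ⟨N, hN⟩ := hG.exists_eigenvalues hlam hi₀ hi₀σ hs₁₂ (hs₂σ.trans_le hσ1)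
  set K := max (stepConst κ) (16 * (κ : ℝ) ^ 2 / f) with hK
  have hK1 : stepConst κ ≤ K := le_max_left _ _
  have hK2 : 16 * (κ : ℝ) ^ 2 / f ≤ K := le_max_right _ _
  have hKone : 1 ≤ K := by
    refine le_trans ?_ hK1
    unfold stepConst
    nlinarith [mul_nonneg (by linarith : 0 ≤ (κ : ℝ)) (sq_nonneg (κ : ℝ))]
  -- With this proportion, `ω (D + 1)` is at most half of the main term `e h / (N + 2)` in the lower
  -- bound for the number of eigenvalues.
  set ω := e / (2 * (N + 2) * (C + 1)) with hω
  obtain ⟨δ, hδ, B, hNT⟩ := card_le_of_conjugates_close (κ : ℝ) hκ1 ω (by positivity)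
  set u := 1 + δ / (κ : ℝ) with hu
  have hu1 : 1 < u := by
    have : 0 < δ / (κ : ℝ) := by positivity
    linarith
  have hlogu : 0 < Real.log u := Real.log_pos hu1
  have hlogK : 0 ≤ Real.log K := Real.log_nonneg hKone
  -- Chosen so that the loss `K ^ ∑ l i` over the short blocks is at most `u ^ h`, leaving a factor
  -- `u ^ h` of the separation `u ^ (2 h)`. The `+ 1` avoids division by `log K = 0`.
  set e' := Real.log u / ((g + 1) * (Real.log K + 1)) with he'
  have he'0 : 0 < e' := by positivity
  set A := (C + 1) * K ^ (2 * (g + 1) + 3) with hA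
  obtain ⟨H₁, hH₁⟩ := exists_bound_of_pow_le hu1 A
  -- Beyond `H₁` conjugates are forced within `δ`; beyond the second bound the other half of the
  -- eigenvalue count outweighs the `B` exceptions.
  refine ⟨e', he'0, max H₁ (2 * (N + 2) * (B + 1) / e), ?_⟩
  intro l hl hlast hAC hD hlong hshort
  by_contra hcon
  rw [not_le, max_lt_iff] at hcon
  obtain ⟨hcon1, hcon2⟩ := hcon
  have R := hG.monotoneRows hlam hl hlast
  have hh1 : 1 ≤ head l := hl 0
  have hh1' : (1 : ℝ) ≤ head l := by exact_mod_cast hh1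
  have hD1 : (diam l + 1 : ℝ) ≤ (C + 1) * head l := by linarith
  have hclose : ∀ θ θ' : ℝ, κ - s₂ ^ 2 ≤ θ → θ ≤ θ' → θ' ≤ κ - s₁ ^ 2 → IsEigenvalue κ G l θ →
      IsEigenvalue κ G l θ' → IsConjRoot ℚ θ θ' → θ' - θ ≤ δ := by
    intro θ θ' h1 hle h2 hθ hθ' hconj
    by_contra hgt
    have hpow := hG.pow_head_le hlam hl hlast hs₁0.le hs₁₂.le hs₂σ.le hσ0 hσ2 hf hK1 hK2 hwell h1 hle
      h2 hθ (hAC θ θ' hθ hθ' hconj)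
    have hsum : ((∑ i ∈ shortBlocks G σ, l i : ℕ) : ℝ) ≤ (g + 1) * (e' * head l) := by
      push_cast
      calc ∑ i ∈ shortBlocks G σ, (l i : ℝ) ≤ ∑ i ∈ shortBlocks G σ, e' * head l := by
            refine sum_le_sum fun i hi => ?_
            rw [shortBlocks, mem_filter] at hi
            exact hshort i hi.2.1 (hi.2.2.1.trans_le hσ2) (hi.2.2.2.trans_le hσ1)
        _ ≤ (g + 1) * (e' * head l) := by
            rw [sum_const, nsmul_eq_mul]
            refine mul_le_mul_of_nonneg_right ?_ (by positivity)
            have := card_le_univ (shortBlocks G σ)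
            rw [Fintype.card_fin] at this
            exact_mod_cast this
    have hKpow : K ^ (∑ i ∈ shortBlocks G σ, l i) ≤ u ^ head l := by
      rw [← Real.log_le_log_iff (by positivity) (by positivity), Real.log_pow, Real.log_pow]
      calc _ ≤ (g + 1) * (e' * head l) * Real.log K := mul_le_mul_of_nonneg_right hsum hlogK
        _ ≤ (g + 1) * (e' * head l) * (Real.log K + 1) := by gcongr; linarith
        _ = head l * Real.log u := by rw [he']; field_simp
    have hupow : u ^ (2 * head l) ≤ (1 + (θ' - θ) / κ) ^ (2 * head l) := by
      refine pow_le_pow_left₀ (by linarith) ?_ _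
      have : δ / (κ : ℝ) ≤ (θ' - θ) / κ := by gcongr; linarith
      linarith
    refine absurd (hH₁ (head l) hh1 ?_) (not_le.2 hcon1)
    have hupos : 0 < u ^ head l := by positivity
    refine le_of_mul_le_mul_right ?_ hupos
    calc u ^ head l * u ^ head l = u ^ (2 * head l) := by rw [two_mul, pow_add]
      _ ≤ _ := hupow
      _ ≤ _ := hpow
      _ = (diam l + 1) * K ^ (2 * (g + 1) + 3) * K ^ (∑ i ∈ shortBlocks G σ, l i) := by ring
      _ ≤ ((C + 1) * head l) * K ^ (2 * (g + 1) + 3) * u ^ head l := by gcongr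
      _ = A * head l * u ^ head l := by rw [hA]; ring
  obtain ⟨S, hSeig, hScard⟩ := hN l hl hlast
  obtain ⟨P, hPm, hPdeg, hPmap⟩ := exists_int_charpoly (diam l) (cSeq G l) (aSeq G l) (bSeq κ G l)
    (fun m => by unfold cSeq; split_ifs; exacts [⟨0, by simp⟩, ⟨_, rfl⟩])
    (fun m => by unfold aSeq; split_ifs; exacts [⟨0, by simp⟩, ⟨_, rfl⟩])
    (fun m => by unfold bSeq; split_ifs; exacts [⟨κ, rfl⟩, ⟨_, rfl⟩])
  have hfinal := hNT P hPm (by rw [hPmap]; exact R.splits_charpoly)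
    (by rw [hPmap]; exact R.nodup_roots)
    (by
      rw [hPmap]
      exact fun x hx => R.abs_le_of_hasEigenvalue (hasEigenvalue_iff_mem_roots.2 hx)) S
    (by
      intro x hx
      rw [hPmap, Multiset.mem_toFinset]
      exact hasEigenvalue_iff_mem_roots.1 (hSeig x hx).1)
    (by
      intro x hx y hy hxy
      obtain ⟨x1, x2, x3⟩ := hSeig x hx
      obtain ⟨y1, y2, y3⟩ := hSeig y hy
      rcases le_total x y with h | h
      · rw [abs_sub_comm, abs_of_nonneg (by linarith)]
        exact hclose x y x2 h y3 x1 y1 hxy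
      · rw [abs_of_nonneg (by linarith)]
        exact hclose y x y2 h x3 y1 x1 hxy.symm)
  rw [hPdeg] at hfinal
  push_cast at hfinal
  have hωD : ω * (diam l + 1) ≤ e * head l / (2 * (N + 2)) := by
    calc ω * (diam l + 1) ≤ ω * ((C + 1) * head l) := by gcongr
      _ = _ := by rw [hω]; field_simp
  have hN2 : (0 : ℝ) < N + 2 := by positivity
  rw [div_lt_iff₀ he] at hcon2
  have h1 : e * head l < (B + e * head l / (2 * (N + 2)) + 1) * (N + 2) := by
    calc e * head l ≤ l i₀ := hlong
      _ < (#S + 1) * (N + 2) := hScard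
      _ ≤ _ := by gcongr; linarith
  have h2 : (B + e * head l / (2 * (N + 2)) + 1) * (N + 2) =
      (B + 1) * (N + 2) + e * head l / 2 := by field_simp; ring
  rw [h2] at h1
  linarith

/-- If a block whose spectral interval extends to the right of the one of the head is long, then
the head is bounded. -/
theorem IsGraphical.head_bounded_of_long (hG : IsGraphical κ lam G) (hlam : lam + 2 ≤ κ)
    {C : ℝ} (hC : 0 < C) (n : ℕ) : ∀ i₀ : Fin (g + 1), i₀ ≠ Fin.last g →
    |√((G i₀).bet : ℝ) - √((G i₀).gam : ℝ)| < √((κ - lam - 1 : ℕ) : ℝ) - 1 →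
    #{i | √((G i).bet : ℝ) + √((G i).gam : ℝ) < √((G i₀).bet : ℝ) + √((G i₀).gam : ℝ)} ≤ n →
    ∀ e : ℝ, 0 < e → ∃ H : ℝ, ∀ l : Fin (g + 1) → ℕ, (∀ i, 0 < l i) → l (Fin.last g) = 1 →
      PropertyAC κ G l → (diam l : ℝ) ≤ C * head l → e * head l ≤ l i₀ → (head l : ℝ) ≤ H := by
  classical
  induction n using Nat.strong_induction_on with
  | _ n ih =>
    -- A block with smaller `√β + √γ` has strictly fewer blocks below it, so it may replace `i₀`,
    -- with the smaller proportion `e'` in place of `e`.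
    intro i₀ hi₀ hmid hn e he
    obtain ⟨e', he', H₁, hH₁⟩ := hG.head_bounded_of_short hlam hC hi₀ hmid he
    have hex : ∀ i : Fin (g + 1), ∃ H : ℝ, i ≠ Fin.last g →
        |√((G i).bet : ℝ) - √((G i).gam : ℝ)| < √((κ - lam - 1 : ℕ) : ℝ) - 1 →
        √((G i).bet : ℝ) + √((G i).gam : ℝ) < √((G i₀).bet : ℝ) + √((G i₀).gam : ℝ) →
        ∀ l : Fin (g + 1) → ℕ, (∀ i, 0 < l i) → l (Fin.last g) = 1 →
          PropertyAC κ G l → (diam l : ℝ) ≤ C * head l → e' * head l ≤ l i → (head l : ℝ) ≤ H := by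
      intro i
      by_cases h : i ≠ Fin.last g ∧
        |√((G i).bet : ℝ) - √((G i).gam : ℝ)| < √((κ - lam - 1 : ℕ) : ℝ) - 1 ∧
        √((G i).bet : ℝ) + √((G i).gam : ℝ) < √((G i₀).bet : ℝ) + √((G i₀).gam : ℝ)
      · have hlt : #{j | √((G j).bet : ℝ) + √((G j).gam : ℝ) <
            √((G i).bet : ℝ) + √((G i).gam : ℝ)} < n := by
          refine lt_of_lt_of_le (card_lt_card ?_) hn
          rw [ssubset_iff_of_subset]
          · exact ⟨i, by simpa using h.2.2, by simp⟩
          · intro j hj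
            rw [mem_filter] at hj ⊢
            exact ⟨hj.1, hj.2.trans h.2.2⟩
        obtain ⟨H, hH⟩ := ih _ hlt i h.1 h.2.1 le_rfl e' he'
        exact ⟨H, fun _ _ _ => hH⟩
      · exact ⟨0, fun h1 h2 h3 => absurd ⟨h1, h2, h3⟩ h⟩
    choose H hH using hex
    obtain ⟨H₂, hH₂⟩ := (Set.finite_range H).bddAbove
    refine ⟨max H₁ H₂, fun l hl hlast hAC hD hlong => ?_⟩
    by_cases hs : ∀ i, i ≠ Fin.last g →
        |√((G i).bet : ℝ) - √((G i).gam : ℝ)| < √((κ - lam - 1 : ℕ) : ℝ) - 1 →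
        √((G i).bet : ℝ) + √((G i).gam : ℝ) < √((G i₀).bet : ℝ) + √((G i₀).gam : ℝ) →
        (l i : ℝ) ≤ e' * head l
    · exact (hH₁ l hl hlast hAC hD hlong hs).trans (le_max_left _ _)
    · push Not at hs
      obtain ⟨i, h1, h2, h3, h4⟩ := hs
      exact ((hH i h1 h2 h3 l hl hlast hAC hD h4.le).trans (hH₂ (Set.mem_range_self i))).trans
        (le_max_right _ _)

end Bound

end BannaiIto

theorem proposition4p3
    (C : ℕ → ℝ) (κ lam : ℕ) (hκ : 3 ≤ κ) (hlam : lam + 2 ≤ κ) (hC : 0 < C κ)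
    (g : ℕ) (G : Fin (g + 1) → BannaiIto.Triple) (hG : BannaiIto.IsGraphical κ lam G)
    (ε : ℝ) (hε : 0 < ε) :
    ∃ H : ℝ, 0 < H ∧ ∀ l : Fin (g + 1) → ℕ, (∀ i, 0 < l i) → l (Fin.last g) = 1 →
      BannaiIto.PropertyAC κ G l →
      (BannaiIto.diam l : ℝ) ≤ C κ * (BannaiIto.head l : ℝ) →
      (BannaiIto.diam l : ℝ) - ((BannaiIto.head l : ℝ) + (BannaiIto.tail κ lam G l : ℝ)) >
        ε * (BannaiIto.head l : ℝ) →
      (BannaiIto.head l : ℝ) ≤ H := by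
  classical
  set I : Finset (Fin (g + 1)) :=
    {i | i ≠ 0 ∧ i ≠ Fin.last g ∧ G i ≠ (κ - lam - 1, lam, 1)} with hI
  -- If every intermediate block were shorter than `e h`, together they would have at most `ε h / 2`
  -- rows.
  set e := ε / (2 * (g + 1)) with he
  have he0 : 0 < e := by positivity
  have hex : ∀ i : Fin (g + 1), ∃ H : ℝ, i ∈ I → ∀ l : Fin (g + 1) → ℕ, (∀ i, 0 < l i) →
      l (Fin.last g) = 1 → BannaiIto.PropertyAC κ G l →
      (BannaiIto.diam l : ℝ) ≤ C κ * BannaiIto.head l → e * BannaiIto.head l ≤ l i →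
      (BannaiIto.head l : ℝ) ≤ H := by
    intro i
    by_cases h : i ∈ I
    · have h' := h
      rw [hI, mem_filter] at h'
      obtain ⟨-, h1, h2, h3⟩ := h'
      obtain ⟨H, hH⟩ := hG.head_bounded_of_long hlam hC _ i h2
        (hG.abs_sqrt_sub_lt hlam h1 h2 h3) le_rfl e he0
      exact ⟨H, fun _ => hH⟩
    · exact ⟨0, fun h' => absurd h' h⟩
  choose H hH using hex
  obtain ⟨H₂, hH₂⟩ := (Set.finite_range H).bddAbove
  -- The term `2 / ε` absorbs the one remaining position `D`: beyond it, `1 < ε h / 2`.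
  refine ⟨max H₂ (2 / ε), lt_max_of_lt_right (by positivity), fun l hl hlast hAC hD hlong => ?_⟩
  by_contra hcon
  rw [not_le, max_lt_iff] at hcon
  have hsum := BannaiIto.diam_le_head_add_tail_add (κ := κ) (lam := lam) (G := G) hlast
  rw [← hI] at hsum
  have hsum' : (BannaiIto.diam l : ℝ) ≤ BannaiIto.head l + BannaiIto.tail κ lam G l + 1 +
      ∑ i ∈ I, (l i : ℝ) := by exact_mod_cast hsum
  have hsmall : ∀ i ∈ I, (l i : ℝ) ≤ e * BannaiIto.head l := by
    intro i hi
    by_contra hc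
    have h1 := hH i hi l hl hlast hAC hD (not_le.1 hc).le
    linarith [hH₂ (Set.mem_range_self i), hcon.1]
  have hle : ∑ i ∈ I, (l i : ℝ) ≤ ε / 2 * BannaiIto.head l := by
    calc ∑ i ∈ I, (l i : ℝ) ≤ ∑ i ∈ I, e * BannaiIto.head l := sum_le_sum hsmall
      _ = #I * (e * BannaiIto.head l) := by rw [sum_const, nsmul_eq_mul]
      _ ≤ (g + 1) * (e * BannaiIto.head l) := by
          refine mul_le_mul_of_nonneg_right ?_ (by positivity)
          have := card_le_univ I
          rw [Fintype.card_fin] at this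
          exact_mod_cast this
      _ = ε / 2 * BannaiIto.head l := by rw [he]; field_simp
  have h2 := hcon.2
  rw [div_lt_iff₀ hε] at h2
  linarith
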